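/- An instance of the Unsplittable Flow Problem on a Path (UFPP) consists of a path with vertices $0,\dots,m$ and edges $\{e,e+1\}$ ($0\le e<m$) with positive integer capacities $u_e$, and of $n$ tasks, where task $i$ has a start vertex $s_i$ and an end vertex $t_i$ with $s_i<t_i$, a positive integer demand $d_i$ and a positive integer profit $w_i$. Let $b(i)$ be the minimum capacity of an edge on the subpath from $s_i$ to $t_i$, and associate with task $i$ the axis-parallel rectangle $(s_i,b(i),t_i,b(i)-d_i)$ with upper left point $(s_i,b(i))$ and lower right point $(t_i,b(i)-d_i)$. Two rectangles $(x_1,y_1,x_2,y_2)$ and $(x_1',y_1',x_2',y_2')$ are compatible if $x_2\le x_1'$, $x_2'\le x_1$, $y_1\le y_2'$ or $y_1'\le y_2$. A set of tasks is an independent task set (ITS) if the rectangles associated with its tasks are pairwise compatible. Theorem. There is an $O(n^4)$ algorithm that computes, for every UFPP instance, an ITS $F$ of maximum profit $\sum_{i\in F}w_i$. More precisely, there are a fixed program for the random access machine (integer registers and randomly accessible integer arrays; addition, subtraction, comparison and memory access at unit cost) and a constant $C$ such that, on every instance with $n$ tasks and $m$ edges, the program halts after at most $C\,(n^4+m+1)$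 steps and outputs a maximum-profit ITS. If $m<2n$, as may be assumed after a linear-time removal of vertices that are not an end of any task, it halts after at most $C\,n^4$ steps. -/

import Mathlib

/-! ### The machine model

A unit-cost random access machine over the integers, programmed in a structured language.  The
machine has registers and finitely many unbounded, randomly accessible integer arrays; the
arithmetic is addition and subtraction only (no multiplication, division or bit operations, so unit
cost is not a way to smuggle in extra parallelism).  Every operation node of an expression or of a
test costs one step, and so does every executed command; each of these is carried out by a bounded
number of instructions of a standard random access machine. -/

namespace RAM

/-- The memory: integer registers, and arrays of integers, both named by numbers.  A program, being
a finite text, names only finitely many of them. -/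
structure State where
  reg : ℕ → ℤ
  arr : ℕ → ℤ → ℤ

/-- Integer expressions; `get a e` is the entry of array `a` at the position given by `e`. -/
inductive Expr where
  | const (c : ℤ)
  | reg (r : ℕ)
  | add (e₁ e₂ : Expr)
  | sub (e₁ e₂ : Expr)
  | get (a : ℕ) (e : Expr)

/-- The value of an expression. -/
def Expr.eval (σ : State) : Expr → ℤ
  | .const c => c
  | .reg r => σ.reg r
  | .add e₁ e₂ => e₁.eval σ + e₂.eval σ
  | .sub e₁ e₂ => e₁.eval σ - e₂.eval σ
  | .get a e => σ.arr a (e.eval σ)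

/-- The number of steps taken to evaluate an expression. -/
def Expr.cost : Expr → ℕ
  | .const _ => 1
  | .reg _ => 1
  | .add e₁ e₂ => e₁.cost + e₂.cost + 1
  | .sub e₁ e₂ => e₁.cost + e₂.cost + 1
  | .get _ e => e.cost + 1

/-- Tests. -/
inductive Test where
  | le (e₁ e₂ : Expr)
  | eq (e₁ e₂ : Expr)
  | not (b : Test)
  | and (b₁ b₂ : Test)

/-- The meaning of a test. -/
def Test.Holds (σ : State) : Test → Prop
  | .le e₁ e₂ => e₁.eval σ ≤ e₂.eval σ
  | .eq e₁ e₂ => e₁.eval σ = e₂.eval σ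
  | .not b => ¬ b.Holds σ
  | .and b₁ b₂ => b₁.Holds σ ∧ b₂.Holds σ

/-- The number of steps taken to evaluate a test. -/
def Test.cost : Test → ℕ
  | .le e₁ e₂ => e₁.cost + e₂.cost + 1
  | .eq e₁ e₂ => e₁.cost + e₂.cost + 1
  | .not b => b.cost + 1
  | .and b₁ b₂ => b₁.cost + b₂.cost + 1

/-- Programs: `assign r e` puts the value of `e` into register `r`, and `store a i e` puts the value
of `e` into array `a` at the position given by `i`. -/
inductive Cmd where
  | skip
  | assign (r : ℕ) (e : Expr)
  | store (a : ℕ) (i e : Expr)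
  | seq (p q : Cmd)
  | cond (b : Test) (p q : Cmd)
  | loop (b : Test) (p : Cmd)

/-- The memory after writing `v` into register `r`. -/
def State.setReg (σ : State) (r : ℕ) (v : ℤ) : State :=
  { σ with reg := Function.update σ.reg r v }

/-- The memory after writing `v` into array `a` at position `k`. -/
def State.setArr (σ : State) (a : ℕ) (k v : ℤ) : State :=
  { σ with arr := Function.update σ.arr a (Function.update (σ.arr a) k v) }

/-- `Exec p σ t τ`: started in memory `σ`, the program `p` halts after exactly `t` steps, and the
final memory is `τ`. -/
inductive Exec : Cmd → State → ℕ → State → Prop where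
  | skip (σ : State) : Exec .skip σ 1 σ
  | assign (σ : State) (r : ℕ) (e : Expr) :
      Exec (.assign r e) σ (e.cost + 1) (σ.setReg r (e.eval σ))
  | store (σ : State) (a : ℕ) (i e : Expr) :
      Exec (.store a i e) σ (i.cost + e.cost + 1) (σ.setArr a (i.eval σ) (e.eval σ))
  | seq {p q : Cmd} {σ τ ρ : State} {s t : ℕ} (hp : Exec p σ s τ) (hq : Exec q τ t ρ) :
      Exec (.seq p q) σ (s + t) ρ
  | condTrue {b : Test} {p q : Cmd} {σ τ : State} {t : ℕ} (hb : b.Holds σ) (hp : Exec p σ t τ) :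
      Exec (.cond b p q) σ (b.cost + 1 + t) τ
  | condFalse {b : Test} {p q : Cmd} {σ τ : State} {t : ℕ} (hb : ¬ b.Holds σ)
      (hq : Exec q σ t τ) :
      Exec (.cond b p q) σ (b.cost + 1 + t) τ
  | loopDone {b : Test} {p : Cmd} {σ : State} (hb : ¬ b.Holds σ) :
      Exec (.loop b p) σ (b.cost + 1) σ
  | loopStep {b : Test} {p : Cmd} {σ τ ρ : State} {s t : ℕ} (hb : b.Holds σ)
      (hp : Exec p σ s τ) (hl : Exec (.loop b p) τ t ρ) :
      Exec (.loop b p) σ (b.cost + 1 + s + t) ρ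

/-- The machine is deterministic: running time and final memory are determined by the program and
the initial memory. -/
theorem Exec.deterministic {p : Cmd} {σ τ τ' : State} {t t' : ℕ} (h : Exec p σ t τ)
    (h' : Exec p σ t' τ') : t = t' ∧ τ = τ' := by
  induction h generalizing t' τ' with
  | skip | assign | store => cases h'; exact ⟨rfl, rfl⟩
  | seq _ _ ih₁ ih₂ =>
    cases h' with
    | seq h₁ h₂ =>
      obtain ⟨rfl, rfl⟩ := ih₁ h₁
      obtain ⟨rfl, rfl⟩ := ih₂ h₂
      exact ⟨rfl, rfl⟩
  | condTrue hb _ ih =>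
    cases h' with
    | condTrue _ h₁ => obtain ⟨rfl, rfl⟩ := ih h₁; exact ⟨rfl, rfl⟩
    | condFalse hb' _ => exact absurd hb hb'
  | condFalse hb _ ih =>
    cases h' with
    | condTrue hb' _ => exact absurd hb' hb
    | condFalse _ h₁ => obtain ⟨rfl, rfl⟩ := ih h₁; exact ⟨rfl, rfl⟩
  | loopDone hb =>
    cases h' with
    | loopDone => exact ⟨rfl, rfl⟩
    | loopStep hb' => exact absurd hb' hb
  | loopStep hb _ _ ih₁ ih₂ =>
    cases h' with
    | loopDone hb' => exact absurd hb hb'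
    | loopStep _ h₁ h₂ =>
      obtain ⟨rfl, rfl⟩ := ih₁ h₁
      obtain ⟨rfl, rfl⟩ := ih₂ h₂
      exact ⟨rfl, rfl⟩

/-- An array that holds the given `k` numbers at the positions `0, …, k - 1`, and zeros elsewhere. -/
def tabulate {k : ℕ} (f : Fin k → ℕ) : ℤ → ℤ := fun j =>
  if h : 0 ≤ j ∧ j.toNat < k then (f ⟨j.toNat, h.2⟩ : ℤ) else 0

end RAM

/-! ### Independent task sets -/

/-- The axis-parallel rectangle with upper left point `(x₁, y₁)` and lower right point `(x₂, y₂)`. -/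
structure Rectangle where
  x₁ : ℤ
  y₁ : ℤ
  x₂ : ℤ
  y₂ : ℤ

/-- Two rectangles are compatible if they do not overlap (touching is allowed). -/
def Rectangle.Compatible (R S : Rectangle) : Prop :=
  R.x₂ ≤ S.x₁ ∨ S.x₂ ≤ R.x₁ ∨ R.y₁ ≤ S.y₂ ∨ S.y₁ ≤ R.y₂

/-- An instance of the Unsplittable Flow Problem on a Path: the path has the vertices `0, …, m` and
the edges `{e, e + 1}` for `e = 0, …, m - 1`, and there are `n` tasks. -/
structure UFPP where
  m : ℕ
  n : ℕ
  /-- the capacity of the edge `{e, e + 1}` -/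
  cap : Fin m → ℕ
  /-- the start vertex of a task -/
  start : Fin n → Fin (m + 1)
  /-- the end vertex of a task -/
  finish : Fin n → Fin (m + 1)
  demand : Fin n → ℕ
  profit : Fin n → ℕ
  cap_pos : ∀ e, 0 < cap e
  start_lt : ∀ i, start i < finish i
  demand_pos : ∀ i, 0 < demand i
  profit_pos : ∀ i, 0 < profit i

namespace UFPP

variable (I : UFPP)

/-- The edges of the subpath from the start vertex to the end vertex of task `i`. -/
def edges (i : Fin I.n) : Finset (Fin I.m) :=
  Finset.univ.filter fun e => (I.start i : ℕ) ≤ e ∧ (e : ℕ) + 1 ≤ I.finish i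

theorem edges_nonempty (i : Fin I.n) : (I.edges i).Nonempty := by
  have h : (I.start i : ℕ) < I.finish i := I.start_lt i
  have h' : (I.finish i : ℕ) < I.m + 1 := (I.finish i).isLt
  refine ⟨⟨I.start i, by omega⟩, ?_⟩
  simp only [edges, Finset.mem_filter, Finset.mem_univ, true_and]
  omega

/-- The bottleneck capacity `b(i)`: the least capacity of an edge used by task `i`. -/
def bottleneck (i : Fin I.n) : ℕ :=
  (I.edges i).inf' (I.edges_nonempty i) I.cap

/-- The rectangle `(s_i, b(i), t_i, b(i) - d_i)` associated with task `i`; the difference is taken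
in the integers. -/
def rect (i : Fin I.n) : Rectangle where
  x₁ := (I.start i : ℕ)
  y₁ := I.bottleneck i
  x₂ := (I.finish i : ℕ)
  y₂ := (I.bottleneck i : ℤ) - I.demand i

/-- Independent task sets: the associated rectangles are pairwise compatible. -/
def IsITS (F : Finset (Fin I.n)) : Prop :=
  ∀ i ∈ F, ∀ j ∈ F, i ≠ j → (I.rect i).Compatible (I.rect j)

/-- The total profit of a set of tasks. -/
def totalProfit (F : Finset (Fin I.n)) : ℕ := ∑ i ∈ F, I.profit i

/-- Independent task sets of maximum profit. -/
def IsMaxITS (F : Finset (Fin I.n)) : Prop :=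
  I.IsITS F ∧ ∀ G : Finset (Fin I.n), I.IsITS G → I.totalProfit G ≤ I.totalProfit F

/-- The memory that holds the instance as input: `n` and `m` are in registers `0` and `1`; the start
vertices, end vertices, demands and profits of the tasks and the edge capacities are in arrays
`0` to `4`; everything else is zero. -/
def input : RAM.State where
  reg := fun r => match r with
    | 0 => I.n
    | 1 => I.m
    | _ => 0
  arr := fun a => match a with
    | 0 => RAM.tabulate fun i => (I.start i : ℕ)
    | 1 => RAM.tabulate fun i => (I.finish i : ℕ)
    | 2 => RAM.tabulate I.demand
    | 3 => RAM.tabulate I.profit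
    | 4 => RAM.tabulate I.cap
    | _ => fun _ => 0

/-- The memory holds the task set `F` as output: array `5` contains, at the positions
`0, …, n - 1`, the characteristic vector of `F`. -/
def IsOutput (σ : RAM.State) (F : Finset (Fin I.n)) : Prop :=
  ∀ i : Fin I.n, σ.arr 5 (i : ℕ) = if i ∈ F then 1 else 0

end UFPP

/-!
The rectangle of a task `i` is anchored: at a bottleneck edge `e i` of the task, its upper end `b i`
is the capacity. Hence, if another task `a` passes through `e i`, then `b a ≤ b i`, so that the
rectangles of `i` and `a` can only be compatible if that of `a` is below that of `i`.

For tasks `i` and `k`, consider the tasks that are strictly between the anchors `e i` and `e k`, whose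
rectangles have lower ends not below those of `i` and `k` and are compatible with those of `i` and
`k` (`Boxes.Between`). In an independent set `F` of such tasks, let `j` have the lowest lower end.
No other task of `F` passes through `e j`, since it would have to be below `j`. Therefore
the other tasks of `F` are between `i` and `j` or between `j` and `k`, in the same sense
(`Encodes.between_or_between`). Conversely, if `j` is between `i` and `k`, then so is everything
between `i` and `j` or between `j` and `k`, and two independent sets of these two kinds form an
independent set together with `j` (`Encodes.isITS_insert`). The maximum profit between `i` and `k` is
thus the maximum, over all `j`, of the profit of `j` plus the maximum profits between `i` and `j`
and between `j` and `k`. All tasks are between two sentinels.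

The program keeps, for each pair `(i, k)`, the best solution found so far, as a value and a
characteristic vector. It recomputes all `(n + 2) ^ 2` entries from one another, `n + 2` times,
where each recomputation takes linear time. After `r` rounds, all entries that concern fewer than
`r` tasks are optimal (`runs_updateCell`), because the entries `(i, j)` and `(j, k)` concern fewer
tasks than `(i, k)`. This takes `O(n ^ 4)` steps.

The bottleneck edges are found in `O(m + n ^ 2)` steps. The end vertices of the tasks are marked, and
one scan of the path from right to left gives, for each vertex, the best edge before the next marked
vertex. Each task is a union of at most `n + 1` such segments, beginning at its start vertex and
at the marked vertices inside it (`runs_findAnchor`).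

Running times are treated by a small program logic, `Runs`, in which the memory that a program does
not write to is preserved automatically (`Exec.frame`).
-/

/-! ### Running programs within a time bound -/

namespace RAM

@[simp] theorem State.reg_setReg (σ : State) (r q : ℕ) (v : ℤ) :
    (σ.setReg r v).reg q = if q = r then v else σ.reg q := by
  simp [State.setReg, Function.update_apply]

@[simp] theorem State.arr_setReg (σ : State) (r : ℕ) (v : ℤ) : (σ.setReg r v).arr = σ.arr := rfl

@[simp] theorem State.reg_setArr (σ : State) (a : ℕ) (k v : ℤ) : (σ.setArr a k v).reg = σ.reg := rfl

@[simp] theorem State.arr_setArr (σ : State) (a c : ℕ) (k v : ℤ) :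
    (σ.setArr a k v).arr c =
      if c = a then Function.update (σ.arr a) k v else σ.arr c := by
  simp only [State.setArr, Function.update_apply]

/-- Whether the text of the program contains an assignment to register `r`. -/
def Cmd.writesReg (r : ℕ) : Cmd → Bool
  | .skip => false
  | .assign q _ => r == q
  | .store _ _ _ => false
  | .seq p q => p.writesReg r || q.writesReg r
  | .cond _ p q => p.writesReg r || q.writesReg r
  | .loop _ p => p.writesReg r

/-- Whether the text of the program contains a store into array `a`. -/
def Cmd.writesArr (a : ℕ) : Cmd → Bool
  | .skip => false
  | .assign _ _ => false
  | .store c _ _ => a == c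
  | .seq p q => p.writesArr a || q.writesArr a
  | .cond _ p q => p.writesArr a || q.writesArr a
  | .loop _ p => p.writesArr a

/-- `Frame p σ τ`: the memories `σ` and `τ` agree outside of the registers and arrays that occur as
targets in the text of `p`. -/
structure Frame (p : Cmd) (σ τ : State) : Prop where
  reg : ∀ r, p.writesReg r = false → τ.reg r = σ.reg r
  arr : ∀ a, p.writesArr a = false → τ.arr a = σ.arr a

theorem Exec.frame {p : Cmd} {σ τ : State} {t : ℕ} (h : Exec p σ t τ) : Frame p σ τ := by
  induction h with
  | skip => exact ⟨fun _ _ => rfl, fun _ _ => rfl⟩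
  | assign σ r e =>
    refine ⟨fun q hq => ?_, fun _ _ => rfl⟩
    have : q ≠ r := by simpa [Cmd.writesReg] using hq
    simp [this]
  | store σ a i e =>
    refine ⟨fun _ _ => rfl, fun c hc => ?_⟩
    have : c ≠ a := by simpa [Cmd.writesArr] using hc
    simp [this]
  | seq _ _ ih₁ ih₂ =>
    constructor
    · intro r hr
      simp only [Cmd.writesReg, Bool.or_eq_false_iff] at hr
      rw [ih₂.reg r hr.2, ih₁.reg r hr.1]
    · intro r hr
      simp only [Cmd.writesArr, Bool.or_eq_false_iff] at hr
      rw [ih₂.arr r hr.2, ih₁.arr r hr.1]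
  | condTrue _ _ ih =>
    constructor
    · intro r hr
      simp only [Cmd.writesReg, Bool.or_eq_false_iff] at hr
      exact ih.reg r hr.1
    · intro r hr
      simp only [Cmd.writesArr, Bool.or_eq_false_iff] at hr
      exact ih.arr r hr.1
  | condFalse _ _ ih =>
    constructor
    · intro r hr
      simp only [Cmd.writesReg, Bool.or_eq_false_iff] at hr
      exact ih.reg r hr.2
    · intro r hr
      simp only [Cmd.writesArr, Bool.or_eq_false_iff] at hr
      exact ih.arr r hr.2
  | loopDone => exact ⟨fun _ _ => rfl, fun _ _ => rfl⟩
  | loopStep _ _ _ ih₁ ih₂ =>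
    constructor
    · intro r hr
      rw [ih₂.reg r hr, ih₁.reg r hr]
    · intro r hr
      rw [ih₂.arr r hr, ih₁.arr r hr]

/-- A total correctness statement with a time bound: started in `σ`, the program `p` halts after at
most `T` steps in a memory that satisfies `Q`. -/
def Runs (p : Cmd) (σ : State) (T : ℕ) (Q : State → Prop) : Prop :=
  ∃ t τ, Exec p σ t τ ∧ t ≤ T ∧ Q τ

theorem Runs.mono {p : Cmd} {σ : State} {T T' : ℕ} {Q Q' : State → Prop} (h : Runs p σ T Q)
    (hT : T ≤ T') (hQ : ∀ τ, Frame p σ τ → Q τ → Q' τ) : Runs p σ T' Q' := by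
  obtain ⟨t, τ, he, ht, hq⟩ := h
  exact ⟨t, τ, he, ht.trans hT, hQ τ he.frame hq⟩

theorem Runs.seq {p q : Cmd} {σ : State} {T T' : ℕ} {P Q : State → Prop} (hp : Runs p σ T P)
    (hq : ∀ τ, Frame p σ τ → P τ → Runs q τ T' Q) : Runs (.seq p q) σ (T + T') Q := by
  obtain ⟨t, τ, he, ht, h⟩ := hp
  obtain ⟨t', τ', he', ht', h'⟩ := hq τ he.frame h
  exact ⟨t + t', τ', he.seq he', by omega, h'⟩

theorem Runs.cond {b : Test} {p q : Cmd} {σ : State} {T : ℕ} {Q : State → Prop}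
    (hp : b.Holds σ → Runs p σ T Q) (hq : ¬ b.Holds σ → Runs q σ T Q) :
    Runs (.cond b p q) σ (b.cost + 1 + T) Q := by
  by_cases hb : b.Holds σ
  · obtain ⟨t, τ, he, ht, h⟩ := hp hb
    exact ⟨_, τ, .condTrue hb he, by omega, h⟩
  · obtain ⟨t, τ, he, ht, h⟩ := hq hb
    exact ⟨_, τ, .condFalse hb he, by omega, h⟩

/-- Whether the program is free of loops. -/
def Cmd.straight : Cmd → Bool
  | .seq p q => p.straight && q.straight
  | .cond _ p q => p.straight && q.straight
  | .loop _ _ => false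
  | _ => true

/-- The largest number of steps that a loop-free program can take; a loop gets the junk value `0`. -/
def Cmd.cost : Cmd → ℕ
  | .skip => 1
  | .assign _ e => e.cost + 1
  | .store _ i e => i.cost + e.cost + 1
  | .seq p q => p.cost + q.cost
  | .cond b p q => b.cost + 1 + max p.cost q.cost
  | .loop _ _ => 0

open Classical in
/-- The memory in which a loop-free program halts; a loop is treated as `skip`. -/
noncomputable def Cmd.run : Cmd → State → State
  | .assign r e, σ => σ.setReg r (e.eval σ)
  | .store a i e, σ => σ.setArr a (i.eval σ) (e.eval σ)
  | .seq p q, σ => q.run (p.run σ)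
  | .cond b p q, σ => if b.Holds σ then p.run σ else q.run σ
  | _, σ => σ

theorem Runs.of_straight {p : Cmd} {σ : State} {T : ℕ} {Q : State → Prop} (hs : p.straight = true)
    (hT : p.cost ≤ T) (hQ : Q (p.run σ)) : Runs p σ T Q := by
  suffices h : ∀ σ, Runs p σ p.cost (· = p.run σ) from (h σ).mono hT fun τ _ hτ => hτ ▸ hQ
  clear hT hQ
  induction p with
  | skip => exact fun σ => ⟨_, _, .skip σ, le_rfl, rfl⟩
  | assign r e => exact fun σ => ⟨_, _, .assign σ r e, le_rfl, rfl⟩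
  | store a i e => exact fun σ => ⟨_, _, .store σ a i e, le_rfl, rfl⟩
  | seq p q ihp ihq =>
    simp only [Cmd.straight, Bool.and_eq_true] at hs
    intro σ
    exact (ihp hs.1 σ).seq fun τ _ hτ => by subst hτ; exact ihq hs.2 _
  | cond b p q ihp ihq =>
    simp only [Cmd.straight, Bool.and_eq_true] at hs
    intro σ
    refine Runs.cond (fun hb => ?_) (fun hb => ?_)
    · exact (ihp hs.1 σ).mono (le_max_left _ _) fun τ _ hτ => by simp [Cmd.run, hb, hτ]
    · exact (ihq hs.2 σ).mono (le_max_right _ _) fun τ _ hτ => by simp [Cmd.run, hb, hτ]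
  | loop => simp [Cmd.straight] at hs

/-- `forLoop x b p` runs `p` with register `x` counting from `0` up to, but not including, the value
of register `b`. -/
def forLoop (x b : ℕ) (p : Cmd) : Cmd :=
  .seq (.assign x (.const 0))
    (.loop (.not (.le (.reg b) (.reg x))) (.seq p (.assign x (.add (.reg x) (.const 1)))))

/-- The invariant rule for counting loops. The invariant need only speak of what the loop changes:
that everything else is as in the initial memory is available in each round. -/
theorem Runs.forLoop {x b : ℕ} {p : Cmd} {σ : State} {n T : ℕ} (Inv : ℕ → State → Prop)
    (hb : σ.reg b = n) (hx : p.writesReg x = false)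
    (hpb : (RAM.forLoop x b p).writesReg b = false)
    (hInv : ∀ i τ v, Inv i τ → Inv i (τ.setReg x v)) (h0 : Inv 0 σ)
    (step : ∀ i < n, ∀ τ, Frame (RAM.forLoop x b p) σ τ → τ.reg x = i → Inv i τ →
      Runs p τ T (Inv (i + 1))) :
    Runs (RAM.forLoop x b p) σ (n * (T + 9) + 7) (Inv n) := by
  have key : ∀ d i τ, i + d = n → Frame (RAM.forLoop x b p) σ τ → τ.reg x = i → Inv i τ →
      Runs (.loop (.not (.le (.reg b) (.reg x))) (.seq p (.assign x (.add (.reg x) (.const 1)))))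
        τ (d * (T + 9) + 5) (Inv n) := by
    intro d
    induction d with
    | zero =>
      intro i τ hi hf hxi h
      have hτb := hf.reg b hpb
      obtain rfl : i = n := by omega
      refine ⟨_, τ, .loopDone ?_, ?_, h⟩
      · simp [Test.Holds, Expr.eval, hxi, hτb, hb]
      · simp [Test.cost, Expr.cost]
    | succ d ih =>
      intro i τ hi hf hxi h
      have hτb := hf.reg b hpb
      have hlt : i < n := by omega
      obtain ⟨t, τ₁, he, ht, h₁⟩ := step i hlt τ hf hxi h
      have hx₁ : τ₁.reg x = i := by rw [he.frame.reg x hx, hxi]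
      have he' := he.seq (Exec.assign τ₁ x (.add (.reg x) (.const 1)))
      have hf' : Frame (RAM.forLoop x b p) σ
          (τ₁.setReg x ((Expr.add (.reg x) (.const 1)).eval τ₁)) := by
        constructor
        · intro r hr
          rw [he'.frame.reg r, hf.reg r hr]
          have : ¬r = x ∧ p.writesReg r = false ∧ ¬r = x := by
            simpa [RAM.forLoop, Cmd.writesReg] using hr
          simp [Cmd.writesReg, this.1, this.2.1]
        · intro a ha
          rw [he'.frame.arr a, hf.arr a ha]
          simpa [RAM.forLoop, Cmd.writesArr] using ha
      obtain ⟨t', τ', hl, ht', hQ⟩ := ih (i + 1) _ (by omega) hf'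
        (by simp [Expr.eval, hx₁]) (hInv _ _ _ h₁)
      refine ⟨_, τ', .loopStep ?_ he' hl, ?_, hQ⟩
      · simp [Test.Holds, Expr.eval, hxi, hτb, hb, hlt]
      · simp only [Test.cost, Expr.cost]
        ring_nf at ht' ⊢
        omega
  have h₀ := Exec.assign σ x (.const 0)
  obtain ⟨t', τ', hl, ht', hQ⟩ := key n 0 (σ.setReg x 0) (by omega)
    ⟨fun r hr => by
      have : r ≠ x := by
        rintro rfl
        simp [RAM.forLoop, Cmd.writesReg] at hr
      simp [this], fun _ _ => rfl⟩ (by simp) (hInv _ _ _ h0)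
  exact ⟨_, τ', h₀.seq hl, by simp only [Expr.cost]; omega, hQ⟩

end RAM

/-! ### The recursion for independent task sets -/

/-- Numerical data of the rectangles of the tasks, and of two additional sentinels: `s`, `t` are the
left and right ends, `b`, `y` the upper and lower ends, and `e` is the anchor. The tasks are numbered
from `0`. -/
structure Boxes where
  s : ℕ → ℤ
  t : ℕ → ℤ
  b : ℕ → ℤ
  y : ℕ → ℤ
  e : ℕ → ℤ

/-- Box `j` lies strictly between the anchors of `i` and `k`, its lower end is not below those of
`i` and `k`, and it is disjoint from them. -/
def Boxes.Between (D : Boxes) (i k j : ℕ) : Prop :=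
  D.e i < D.s j ∧ D.t j ≤ D.e k ∧ D.y i ≤ D.y j ∧ D.y k ≤ D.y j ∧
    (D.t i ≤ D.s j ∨ D.b i ≤ D.y j) ∧ (D.t j ≤ D.s k ∨ D.b k ≤ D.y j)

namespace UFPP

variable {I : UFPP}

/-- The boxes with numbers below `n` are the rectangles of the tasks of the instance, each one
anchored at a bottleneck edge: `e i` is an edge of task `i`, and no task through `e i` reaches
higher than task `i`. -/
structure Encodes (I : UFPP) (D : Boxes) : Prop where
  s_eq : ∀ j : Fin I.n, D.s j = (I.start j : ℕ)
  t_eq : ∀ j : Fin I.n, D.t j = (I.finish j : ℕ)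
  b_eq : ∀ j : Fin I.n, D.b j = I.bottleneck j
  y_eq : ∀ j : Fin I.n, D.y j = (I.bottleneck j : ℤ) - I.demand j
  s_le_e : ∀ j : Fin I.n, D.s j ≤ D.e j
  e_lt_t : ∀ j : Fin I.n, D.e j < D.t j
  b_le_b : ∀ i j : Fin I.n, D.s j ≤ D.e i → D.e i < D.t j → D.b j ≤ D.b i

variable {D : Boxes}

namespace Encodes

theorem y_lt_b (h : I.Encodes D) (j : Fin I.n) : D.y j < D.b j := by
  have := I.demand_pos j
  rw [h.y_eq, h.b_eq]
  omega

theorem compatible_iff (h : I.Encodes D) (i j : Fin I.n) : (I.rect i).Compatible (I.rect j) ↔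
    D.t i ≤ D.s j ∨ D.t j ≤ D.s i ∨ D.b i ≤ D.y j ∨ D.b j ≤ D.y i := by
  simp only [Rectangle.Compatible, UFPP.rect, h.t_eq, h.s_eq, h.b_eq, h.y_eq]

theorem between_of_left (h : I.Encodes D) {i k a : ℕ} {j : Fin I.n} (hj : D.Between i k j)
    (ha : D.Between i j a) : D.Between i k a := by
  have := h.e_lt_t j
  unfold Boxes.Between at *
  omega

theorem between_of_right (h : I.Encodes D) {i k a : ℕ} {j : Fin I.n} (hj : D.Between i k j)
    (ha : D.Between j k a) : D.Between i k a := by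
  have := h.s_le_e j
  unfold Boxes.Between at *
  omega

theorem ne_left (h : I.Encodes D) {i k : ℕ} {j : Fin I.n} (hj : D.Between i k j) :
    (j : ℕ) ≠ i := by
  rintro rfl
  have := h.s_le_e j
  unfold Boxes.Between at hj
  omega

theorem ne_right (h : I.Encodes D) {i k : ℕ} {j : Fin I.n} (hj : D.Between i k j) :
    (j : ℕ) ≠ k := by
  rintro rfl
  have := h.e_lt_t j
  unfold Boxes.Between at hj
  omega

/-- In an independent task set, let `j` be a task with lowest lower end. No other task passes
through the anchor of `j`: it would have to lie above `j`, but at its anchor, `j` reaches up to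
the capacity. Hence every other task is on one side of the anchor. -/
theorem between_or_between (h : I.Encodes D) {i k : ℕ} {j a : Fin I.n} (ha : D.Between i k a)
    (hja : (I.rect j).Compatible (I.rect a)) (hy : D.y j ≤ D.y a) :
    D.Between i j a ∨ D.Between j k a := by
  rw [h.compatible_iff] at hja
  have h₁ := h.s_le_e j
  have h₂ := h.e_lt_t j
  have h₃ := h.s_le_e a
  have h₄ := h.e_lt_t a
  have h₅ := h.y_lt_b j
  have h₆ := h.y_lt_b a
  have h₇ := h.b_le_b j a
  unfold Boxes.Between at *
  omega

end Encodes

open Classical in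
/-- The tasks whose boxes lie between `i` and `k`. -/
noncomputable def between (I : UFPP) (D : Boxes) (i k : ℕ) : Finset (Fin I.n) :=
  Finset.univ.filter fun j => D.Between i k j

@[simp] theorem mem_between {i k : ℕ} {j : Fin I.n} : j ∈ I.between D i k ↔ D.Between i k j := by
  simp [between]

theorem IsITS.subset {F G : Finset (Fin I.n)} (hG : I.IsITS G) (h : F ⊆ G) : I.IsITS F :=
  fun i hi j hj => hG i (h hi) j (h hj)

namespace Encodes

theorem card_left_lt (h : I.Encodes D) {i k : ℕ} {j : Fin I.n} (hj : D.Between i k j) :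
    (I.between D i j).card < (I.between D i k).card := by
  refine Finset.card_lt_card (Finset.ssubset_iff_of_subset ?_ |>.2 ⟨j, ?_, ?_⟩)
  · intro a ha
    rw [mem_between] at *
    exact h.between_of_left hj ha
  · simpa using hj
  · rw [mem_between]
    exact fun hc => h.ne_right hc rfl

theorem card_right_lt (h : I.Encodes D) {i k : ℕ} {j : Fin I.n} (hj : D.Between i k j) :
    (I.between D j k).card < (I.between D i k).card := by
  refine Finset.card_lt_card (Finset.ssubset_iff_of_subset ?_ |>.2 ⟨j, ?_, ?_⟩)
  · intro a ha
    rw [mem_between] at *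
    exact h.between_of_right hj ha
  · simpa using hj
  · rw [mem_between]
    exact fun hc => h.ne_left hc rfl

theorem disjoint (h : I.Encodes D) {i k : ℕ} {j : Fin I.n} {A B : Finset (Fin I.n)}
    (hA : A ⊆ I.between D i j) (hB : B ⊆ I.between D j k) : Disjoint A B := by
  rw [Finset.disjoint_left]
  intro a ha hb
  have h₁ := mem_between.1 (hA ha)
  have h₂ := mem_between.1 (hB hb)
  have h₃ := h.s_le_e a
  have h₄ := h.e_lt_t a
  unfold Boxes.Between at *
  omega

theorem notMem_union (h : I.Encodes D) {i k : ℕ} {j : Fin I.n} {A B : Finset (Fin I.n)}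
    (hA : A ⊆ I.between D i j) (hB : B ⊆ I.between D j k) : j ∉ A ∪ B := by
  rw [Finset.mem_union]
  rintro (hj | hj)
  · exact h.ne_right (mem_between.1 (hA hj)) rfl
  · exact h.ne_left (mem_between.1 (hB hj)) rfl

theorem insert_subset (h : I.Encodes D) {i k : ℕ} {j : Fin I.n} {A B : Finset (Fin I.n)}
    (hj : D.Between i k j) (hA : A ⊆ I.between D i j) (hB : B ⊆ I.between D j k) :
    insert j (A ∪ B) ⊆ I.between D i k := by
  intro a ha
  rw [Finset.mem_insert, Finset.mem_union] at ha
  rw [mem_between]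
  rcases ha with rfl | ha | ha
  · exact hj
  · exact h.between_of_left hj (mem_between.1 (hA ha))
  · exact h.between_of_right hj (mem_between.1 (hB ha))

theorem isITS_insert (h : I.Encodes D) {i k : ℕ} {j : Fin I.n} {A B : Finset (Fin I.n)}
    (hA : A ⊆ I.between D i j) (hB : B ⊆ I.between D j k) (hA' : I.IsITS A) (hB' : I.IsITS B) :
    I.IsITS (insert j (A ∪ B)) := by
  have hAB : ∀ a ∈ A, ∀ c ∈ B, D.t a ≤ D.s c := by
    intro a ha c hc
    have h₁ := mem_between.1 (hA ha)
    have h₂ := mem_between.1 (hB hc)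
    unfold Boxes.Between at *
    omega
  have hAj : ∀ a ∈ A, D.t a ≤ D.s j ∨ D.b j ≤ D.y a := fun a ha =>
    (mem_between.1 (hA ha)).2.2.2.2.2
  have hjB : ∀ c ∈ B, D.t j ≤ D.s c ∨ D.b j ≤ D.y c := fun c hc =>
    (mem_between.1 (hB hc)).2.2.2.2.1
  intro a ha c hc hne
  simp only [Finset.mem_insert, Finset.mem_union] at ha hc
  rcases ha with rfl | ha | ha <;> rcases hc with rfl | hc | hc
  · exact absurd rfl hne
  · have := hAj c hc
    rw [h.compatible_iff]; tauto
  · have := hjB c hc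
    rw [h.compatible_iff]; tauto
  · have := hAj a ha
    rw [h.compatible_iff]; tauto
  · exact hA' a ha c hc hne
  · have := hAB a ha c hc
    rw [h.compatible_iff]; tauto
  · have := hjB a ha
    rw [h.compatible_iff]; tauto
  · have := hAB c hc a ha
    rw [h.compatible_iff]; tauto
  · exact hB' a ha c hc hne

theorem totalProfit_insert (h : I.Encodes D) {i k : ℕ} {j : Fin I.n} {A B : Finset (Fin I.n)}
    (hA : A ⊆ I.between D i j) (hB : B ⊆ I.between D j k) :
    I.totalProfit (insert j (A ∪ B)) = I.totalProfit A + I.profit j + I.totalProfit B := by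
  unfold totalProfit
  rw [Finset.sum_insert (h.notMem_union hA hB), Finset.sum_union (h.disjoint hA hB)]
  ring

/-- An independent task set between `i` and `k` consists of a task `j` with lowest lower end, an
independent task set between `i` and `j`, and one between `j` and `k`. -/
theorem exists_split (h : I.Encodes D) {i k : ℕ} {G : Finset (Fin I.n)} (hG : I.IsITS G)
    (hGs : G ⊆ I.between D i k) (hne : G.Nonempty) :
    ∃ j : Fin I.n, D.Between i k j ∧ ∃ A B, A ⊆ I.between D i j ∧ B ⊆ I.between D j k ∧ I.IsITS A ∧
      I.IsITS B ∧ I.totalProfit G = I.totalProfit A + I.profit j + I.totalProfit B := by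
  obtain ⟨j, hj, hmin⟩ := G.exists_min_image (fun j : Fin I.n => D.y j) hne
  have hA : G ∩ I.between D i j ⊆ I.between D i j := Finset.inter_subset_right
  have hB : G ∩ I.between D j k ⊆ I.between D j k := Finset.inter_subset_right
  have hjb := mem_between.1 (hGs hj)
  refine ⟨j, hjb, _, _, hA, hB, hG.subset Finset.inter_subset_left,
    hG.subset Finset.inter_subset_left, ?_⟩
  rw [← h.totalProfit_insert hA hB]
  congr 1
  ext a
  simp only [Finset.mem_insert, Finset.mem_union, Finset.mem_inter, mem_between]
  constructor
  · intro ha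
    by_cases haj : a = j
    · exact Or.inl haj
    · have := h.between_or_between (mem_between.1 (hGs ha)) (hG j hj a ha (Ne.symm haj))
        (hmin a ha)
      tauto
  · rintro (rfl | ha | ha)
    exacts [hj, ha.1, ha.1]

end Encodes

end UFPP

/-! ### Finding the bottleneck edges -/

namespace UFPP

open RAM

variable {I : UFPP}

/-- The memory still holds the instance in the registers and arrays of the input. -/
structure Loaded (I : UFPP) (σ : State) : Prop where
  n_eq : σ.reg 0 = I.n
  m_eq : σ.reg 1 = I.m
  start_eq : ∀ j : Fin I.n, σ.arr 0 (j : ℕ) = (I.start j : ℕ)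
  finish_eq : ∀ j : Fin I.n, σ.arr 1 (j : ℕ) = (I.finish j : ℕ)
  demand_eq : ∀ j : Fin I.n, σ.arr 2 (j : ℕ) = I.demand j
  profit_eq : ∀ j : Fin I.n, σ.arr 3 (j : ℕ) = I.profit j
  cap_eq : ∀ e : Fin I.m, σ.arr 4 (e : ℕ) = I.cap e

theorem loaded_input : I.Loaded I.input := by
  constructor <;> simp [input, tabulate]

theorem Loaded.of_eq {σ τ : State} (h : I.Loaded σ) (h0 : τ.reg 0 = σ.reg 0)
    (h1 : τ.reg 1 = σ.reg 1) (a0 : τ.arr 0 = σ.arr 0) (a1 : τ.arr 1 = σ.arr 1)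
    (a2 : τ.arr 2 = σ.arr 2) (a3 : τ.arr 3 = σ.arr 3) (a4 : τ.arr 4 = σ.arr 4) : I.Loaded τ := by
  constructor
  · rw [h0, h.n_eq]
  · rw [h1, h.m_eq]
  · rw [a0]; exact h.start_eq
  · rw [a1]; exact h.finish_eq
  · rw [a2]; exact h.demand_eq
  · rw [a3]; exact h.profit_eq
  · rw [a4]; exact h.cap_eq

theorem bottleneck_le {i : Fin I.n} {e : Fin I.m} (h₁ : (I.start i : ℕ) ≤ e)
    (h₂ : (e : ℕ) < I.finish i) : I.bottleneck i ≤ I.cap e :=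
  Finset.inf'_le _ (by simp only [edges, Finset.mem_filter, Finset.mem_univ, true_and]; omega)

theorem le_bottleneck {i : Fin I.n} {c : ℕ} (h : ∀ e : Fin I.m, (I.start i : ℕ) ≤ e →
    (e : ℕ) < I.finish i → c ≤ I.cap e) : c ≤ I.bottleneck i := by
  refine Finset.le_inf' _ _ fun e he => ?_
  simp only [edges, Finset.mem_filter, Finset.mem_univ, true_and] at he
  exact h e (by omega) (by omega)

/-- Marks the last vertex of the path and the end vertices of the tasks in array `6`. -/
def markFinishes : Cmd :=
  .seq (.store 6 (.reg 1) (.const 1)) (forLoop 6 0 (.store 6 (.get 1 (.reg 6)) (.const 1)))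

theorem runs_markFinishes {σ : State} (h : I.Loaded σ) (h6 : ∀ x, σ.arr 6 x = 0) :
    Runs markFinishes σ (3 + (I.n * (4 + 9) + 7)) fun τ =>
      ∀ x, τ.arr 6 x = 1 ↔ x = I.m ∨ ∃ j : Fin I.n, x = (I.finish j : ℕ) := by
  refine Runs.seq (P := fun τ => ∀ x, τ.arr 6 x = 1 ↔ x = I.m)
    (Runs.of_straight rfl (by decide) ?_) fun τ hf hτ => ?_
  · intro x
    simp [Cmd.run, Expr.eval, Function.update_apply, h6, h.m_eq]
  refine (Runs.forLoop (n := I.n) (T := 4) (fun i ρ => ∀ x, ρ.arr 6 x = 1 ↔ x = I.m ∨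
    ∃ j : Fin I.n, (j : ℕ) < i ∧ x = (I.finish j : ℕ)) ?_ rfl rfl ?_ ?_ ?_).mono le_rfl ?_
  · rw [hf.reg 0 rfl, h.n_eq]
  · intro i ρ v hρ
    simpa using hρ
  · simpa using hτ
  · intro i hi ρ hf' hx hρ
    refine Runs.of_straight rfl (by decide) fun x => ?_
    have h1 : ρ.arr 1 (i : ℕ) = (I.finish ⟨i, hi⟩ : ℕ) := by
      rw [hf'.arr 1 rfl, hf.arr 1 rfl, ← h.finish_eq]
    simp only [Cmd.run, Expr.eval, State.arr_setArr, hx, h1, if_true]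
    rw [Function.update_apply]
    split_ifs with hc
    · simp only [true_iff]
      exact Or.inr ⟨⟨i, hi⟩, by simp, hc⟩
    · rw [hρ x]
      refine or_congr_right (exists_congr fun j => and_congr_left fun hj => ?_)
      have : (j : ℕ) ≠ i := by
        intro hji
        apply hc
        rw [hj]
        congr 3
        exact Fin.ext hji
      omega
  · intro ρ _ hρ x
    simp [hρ x]

/-- No vertex `w` with `v < w ≤ x` is marked, i.e. the edge `x` belongs to the segment of the path
from `v` to the next marked vertex. -/
def Unmarked (M : ℕ → Prop) (v x : ℕ) : Prop := ∀ w, v < w → w ≤ x → ¬ M w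

/-- Edge `u` has least capacity among the edges from `v` to the next marked vertex. -/
structure SegmentMin (M : ℕ → Prop) (c : ℕ → ℤ) (m v u : ℕ) : Prop where
  le : v ≤ u
  lt : u < m
  unmarked : Unmarked M v u
  min : ∀ x, v ≤ x → x < m → Unmarked M v x → c u ≤ c x

theorem SegmentMin.self {M : ℕ → Prop} {c : ℕ → ℤ} {m v : ℕ} (hv : v < m) (hM : M (v + 1)) :
    SegmentMin M c m v v := by
  refine ⟨le_rfl, hv, fun w h₁ h₂ => by omega, fun x h₁ _ h₃ => ?_⟩
  obtain rfl | h := h₁.eq_or_lt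
  · rfl
  · exact absurd hM (h₃ _ (by omega) (by omega))

theorem SegmentMin.step {M : ℕ → Prop} {c : ℕ → ℤ} {m v u : ℕ} (h : SegmentMin M c m (v + 1) u)
    (hM : ¬ M (v + 1)) : SegmentMin M c m v (if c v ≤ c u then v else u) := by
  have hle := h.le
  have hlt := h.lt
  have hmin : ∀ x, v ≤ x → x < m → Unmarked M v x → x = v ∨ c u ≤ c x := by
    intro x h₁ h₂ h₃
    obtain rfl | h' := h₁.eq_or_lt
    · exact Or.inl rfl
    · exact Or.inr (h.min x h' h₂ fun w hw hw' => h₃ w (by omega) hw')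
  split_ifs with hc
  · refine ⟨le_rfl, by omega, fun w h₁ h₂ => by omega, fun x h₁ h₂ h₃ => ?_⟩
    rcases hmin x h₁ h₂ h₃ with rfl | h'
    · exact le_rfl
    · exact hc.trans h'
  · refine ⟨by omega, h.lt, fun w h₁ h₂ => ?_, fun x h₁ h₂ h₃ => ?_⟩
    · obtain h' | h' := (Nat.succ_le_of_lt h₁).eq_or_lt
      · rwa [← h']
      · exact h.unmarked w h' h₂
    · rcases hmin x h₁ h₂ h₃ with rfl | h'
      · omega
      · exact h'

/-- Scans the path from right to left; array `7` receives, for each vertex, an edge of least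
capacity before the next marked vertex. -/
def scanSegments : Cmd :=
  forLoop 3 1 <|
    .seq (.assign 9 (.sub (.sub (.reg 1) (.const 1)) (.reg 3))) <|
    .cond (.eq (.get 6 (.add (.reg 9) (.const 1))) (.const 1)) (.store 7 (.reg 9) (.reg 9)) <|
    .cond (.le (.get 4 (.reg 9)) (.get 4 (.get 7 (.add (.reg 9) (.const 1)))))
      (.store 7 (.reg 9) (.reg 9))
      (.store 7 (.reg 9) (.get 7 (.add (.reg 9) (.const 1))))

theorem runs_scanSegments {σ : State} (h : I.Loaded σ) (hm : σ.arr 6 I.m = 1) :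
    Runs scanSegments σ (I.m * (40 + 9) + 7) fun τ => ∀ v < I.m, ∃ u : ℕ, τ.arr 7 v = u ∧
      SegmentMin (fun w => σ.arr 6 w = 1) (fun x => σ.arr 4 x) I.m v u := by
  refine (Runs.forLoop (n := I.m) (T := 40) (fun i ρ => ∀ v < I.m, I.m ≤ v + i →
    ∃ u : ℕ, ρ.arr 7 v = u ∧ SegmentMin (fun w => σ.arr 6 w = 1) (fun x => σ.arr 4 x) I.m v u)
    ?_ rfl rfl ?_ ?_ ?_).mono le_rfl ?_
  · exact h.m_eq
  · intro i ρ v hρ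
    simpa using hρ
  · intro v hv hv'
    omega
  · intro i hi ρ hf hx hρ
    refine Runs.of_straight rfl (by decide) ?_
    obtain ⟨v, hvi⟩ : ∃ v, I.m = v + 1 + i := ⟨I.m - 1 - i, by omega⟩
    have h1 : ρ.reg 1 - 1 - ρ.reg 3 = (v : ℤ) := by
      rw [hx, hf.reg 1 rfl, h.m_eq]
      omega
    have hcast : (v : ℤ) + 1 = ((v + 1 : ℕ) : ℤ) := by push_cast; rfl
    have key : ∃ u : ℕ, SegmentMin (fun w => σ.arr 6 w = 1) (fun x => σ.arr 4 x) I.m v u ∧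
        Cmd.run (.seq (.assign 9 (.sub (.sub (.reg 1) (.const 1)) (.reg 3))) <|
          .cond (.eq (.get 6 (.add (.reg 9) (.const 1))) (.const 1)) (.store 7 (.reg 9) (.reg 9)) <|
          .cond (.le (.get 4 (.reg 9)) (.get 4 (.get 7 (.add (.reg 9) (.const 1)))))
            (.store 7 (.reg 9) (.reg 9))
            (.store 7 (.reg 9) (.get 7 (.add (.reg 9) (.const 1))))) ρ =
          (ρ.setReg 9 v).setArr 7 v u := by
      simp only [Cmd.run, Expr.eval, Test.Holds, h1, State.reg_setReg, State.arr_setReg, if_true,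
        hcast, hf.arr 6 rfl, hf.arr 4 rfl]
      split_ifs with hc hc'
      · exact ⟨v, .self (by omega) hc, rfl⟩
      all_goals
        have hv : v + 1 ≠ I.m := by
          intro hv
          rw [hv] at hc
          exact hc hm
        obtain ⟨u, hu, hs⟩ := hρ (v + 1) (by omega) (by omega)
        simp only [hu] at hc' ⊢
        have := hs.step hc
        simp only [hc', if_true, if_false] at this
        exact ⟨_, this, rfl⟩
    obtain ⟨u, hu, hrun⟩ := key
    rw [hrun]
    intro w hw hw'
    simp only [State.arr_setArr, if_true, Function.update_apply, State.arr_setReg]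
    split_ifs with hc
    · obtain rfl : w = v := by exact_mod_cast hc
      exact ⟨u, rfl, hu⟩
    · have : w ≠ v := by exact_mod_cast hc
      exact hρ w hw (by omega)
  · intro ρ _ hρ v hv
    exact hρ v hv (by omega)

/-- Array `8` holds a bottleneck edge, array `9` the bottleneck capacity, and array `10` the lower
end of the rectangle of each task numbered less than `i`. Position `n` of array `10` holds a lower
bound for these lower ends. -/
def Anchored (I : UFPP) (σ : State) (i : ℕ) : Prop :=
  ∀ j : Fin I.n, (j : ℕ) < i →
    (∃ u : Fin I.m, σ.arr 8 (j : ℕ) = (u : ℕ) ∧ (I.start j : ℕ) ≤ u ∧ (u : ℕ) < I.finish j ∧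
      I.cap u = I.bottleneck j) ∧
    σ.arr 9 (j : ℕ) = I.bottleneck j ∧
    σ.arr 10 (j : ℕ) = (I.bottleneck j : ℤ) - I.demand j ∧ σ.arr 10 I.n ≤ σ.arr 10 (j : ℕ)

/-- Finds a bottleneck edge of the task in register `4`: one of the best edges of the segments
that begin at the start vertex or at a marked vertex inside the task. -/
def findAnchor : Cmd :=
  .seq (.assign 8 (.get 7 (.get 0 (.reg 4)))) <|
  forLoop 6 0 <|
    .cond (.and (.le (.get 0 (.reg 4)) (.get 1 (.reg 6))) <|
        .and (.not (.le (.get 1 (.reg 4)) (.get 1 (.reg 6))))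
          (.not (.le (.get 4 (.reg 8)) (.get 4 (.get 7 (.get 1 (.reg 6)))))))
      (.assign 8 (.get 7 (.get 1 (.reg 6)))) .skip

theorem runs_findAnchor {σ : State} (h : I.Loaded σ) {M : ℕ → Prop}
    (hM : ∀ x : ℕ, M x ↔ x = I.m ∨ ∃ j : Fin I.n, x = (I.finish j : ℕ))
    (hs : ∀ v < I.m, ∃ u : ℕ, σ.arr 7 v = u ∧ SegmentMin M (fun x => σ.arr 4 x) I.m v u)
    (i : Fin I.n) (hi : σ.reg 4 = (i : ℕ)) :
    Runs findAnchor σ (4 + (I.n * (40 + 9) + 7)) fun τ => ∃ u : Fin I.m, τ.reg 8 = (u : ℕ) ∧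
      (I.start i : ℕ) ≤ u ∧ (u : ℕ) < I.finish i ∧ I.cap u = I.bottleneck i := by
  have hst : (I.start i : ℕ) < I.finish i := I.start_lt i
  have htm : (I.finish i : ℕ) < I.m + 1 := (I.finish i).isLt
  -- A segment that begins inside the task ends inside it, as its end vertex is marked.
  have hseg : ∀ v u, v < (I.finish i : ℕ) → Unmarked M v u → u < I.finish i := by
    intro v u hv hu
    by_contra hc
    exact hu _ hv (by omega) ((hM _).2 (Or.inr ⟨i, rfl⟩))
  refine Runs.seq (P := fun τ => τ.reg 8 = σ.arr 7 (I.start i : ℕ))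
    (Runs.of_straight rfl (by decide) ?_) fun τ hf hτ => ?_
  · simp [Cmd.run, Expr.eval, hi, h.start_eq]
  refine (Runs.forLoop (n := I.n) (T := 40) (fun k ρ => ∃ u : ℕ, ρ.reg 8 = u ∧
    (I.start i : ℕ) ≤ u ∧ u < I.finish i ∧ σ.arr 4 u ≤ σ.arr 4 (σ.arr 7 (I.start i : ℕ)) ∧
    ∀ j : Fin I.n, (j : ℕ) < k → (I.start i : ℕ) ≤ I.finish j → (I.finish j : ℕ) < I.finish i →
      σ.arr 4 u ≤ σ.arr 4 (σ.arr 7 (I.finish j : ℕ))) ?_ rfl rfl ?_ ?_ ?_).mono le_rfl ?_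
  · rw [hf.reg 0 rfl, h.n_eq]
  · intro k ρ v hρ
    simpa using hρ
  · obtain ⟨u, hu, hmin⟩ := hs (I.start i) (by omega)
    exact ⟨u, by rw [hτ, hu], hmin.le, hseg _ _ hst hmin.unmarked, by rw [hu],
      fun j hj => by omega⟩
  · intro k hk ρ hf' hx ⟨u, hu, hu₁, hu₂, hu₃, hu₄⟩
    refine Runs.of_straight rfl (by decide) ?_
    have h4 : ρ.reg 4 = (i : ℕ) := by rw [hf'.reg 4 rfl, hf.reg 4 rfl, hi]
    have e1 := h.start_eq i
    have e2 := h.finish_eq i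
    have e3 := h.finish_eq ⟨k, hk⟩
    simp only at e3
    simp only [Cmd.run, Expr.eval, Test.Holds, h4, hx, hu, hf'.arr _ rfl, hf.arr _ rfl, e1, e2, e3]
    split_ifs with hc
    · obtain ⟨hc₁, hc₂, hc₃⟩ := hc
      have hc₁' : (I.start i : ℕ) ≤ I.finish ⟨k, hk⟩ := by exact_mod_cast hc₁
      have hc₂' : (I.finish ⟨k, hk⟩ : ℕ) < I.finish i := by
        rw [← not_le]; exact_mod_cast hc₂
      rw [not_le] at hc₃
      obtain ⟨x, hx, hmin⟩ := hs (I.finish ⟨k, hk⟩) (by omega)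
      rw [hx] at hc₃
      refine ⟨x, by simp [hx], hc₁'.trans hmin.le, hseg _ _ hc₂' hmin.unmarked,
        hc₃.le.trans hu₃, fun j hj hj₁ hj₂ => ?_⟩
      by_cases hjk : (j : ℕ) = k
      · obtain rfl : j = ⟨k, hk⟩ := Fin.ext hjk
        rw [hx]
      · exact hc₃.le.trans (hu₄ j (by omega) hj₁ hj₂)
    · refine ⟨u, by simp [hu], hu₁, hu₂, hu₃, fun j hj hj₁ hj₂ => ?_⟩
      by_cases hjk : (j : ℕ) = k
      · obtain rfl : j = ⟨k, hk⟩ := Fin.ext hjk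
        by_contra hc'
        exact hc ⟨by exact_mod_cast hj₁, by rw [not_le]; exact_mod_cast hj₂, hc'⟩
      · exact hu₄ j (by omega) hj₁ hj₂
  · rintro ρ - ⟨u, hu, hu₁, hu₂, hu₃, hu₄⟩
    have hum : u < I.m := by omega
    refine ⟨⟨u, hum⟩, hu, hu₁, hu₂, le_antisymm (le_bottleneck fun x hx₁ hx₂ => ?_)
      (bottleneck_le hu₁ hu₂)⟩
    -- The segment of an edge `x` begins at the last vertex before `x` that is marked or is the
    -- start vertex of the task.
    classical
    let v := Nat.findGreatest (fun v => v = I.start i ∨ M v) x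
    have hv : v = I.start i ∨ M v :=
      Nat.findGreatest_spec (P := fun v => v = I.start i ∨ M v) hx₁ (Or.inl rfl)
    have hsv : (I.start i : ℕ) ≤ v :=
      Nat.le_findGreatest (P := fun v => v = I.start i ∨ M v) hx₁ (Or.inl rfl)
    have hvx : v ≤ x := Nat.findGreatest_le _
    have hun : Unmarked M v x := fun w hw hw' hMw =>
      Nat.findGreatest_is_greatest (P := fun v => v = I.start i ∨ M v) hw hw' (Or.inr hMw)
    have hxm : (x : ℕ) < I.m := x.isLt
    obtain ⟨y, hy, hmin⟩ := hs v (by omega)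
    have hyx := hmin.min x hvx hxm hun
    have huy : σ.arr 4 u ≤ σ.arr 4 (σ.arr 7 v) := by
      rcases hv with hv | hv
      · rw [hv]; exact hu₃
      · rcases (hM v).1 hv with hv | ⟨j, hj⟩
        · omega
        · rw [hj]
          exact hu₄ j j.isLt (by omega) (by omega)
    rw [hy] at huy
    have := huy.trans hyx
    rw [h.cap_eq x, show (u : ℤ) = ((⟨u, hum⟩ : Fin I.m) : ℕ) from rfl, h.cap_eq] at this
    exact_mod_cast this

/-- Finds the bottleneck edges of all tasks, and the upper and lower ends of the rectangles. -/
def findAnchors : Cmd :=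
  forLoop 4 0 <|
    .seq findAnchor <|
    .seq (.store 8 (.reg 4) (.reg 8)) <|
    .seq (.store 9 (.reg 4) (.get 4 (.reg 8))) <|
    .seq (.store 10 (.reg 4) (.sub (.get 9 (.reg 4)) (.get 2 (.reg 4)))) <|
    .cond (.le (.get 10 (.reg 4)) (.get 10 (.reg 0)))
      (.store 10 (.reg 0) (.get 10 (.reg 4))) .skip

theorem runs_findAnchors {σ : State} (h : I.Loaded σ) {M : ℕ → Prop}
    (hM : ∀ x : ℕ, M x ↔ x = I.m ∨ ∃ j : Fin I.n, x = (I.finish j : ℕ))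
    (hs : ∀ v < I.m, ∃ u : ℕ, σ.arr 7 v = u ∧ SegmentMin M (fun x => σ.arr 4 x) I.m v u) :
    Runs findAnchors σ (I.n * (4 + (I.n * (40 + 9) + 7) + 40 + 9) + 7) (I.Anchored · I.n) := by
  refine Runs.forLoop (n := I.n) (T := 4 + (I.n * (40 + 9) + 7) + 40)
    (fun i ρ => I.Anchored ρ i) ?_ rfl rfl ?_ ?_ ?_
  · exact h.n_eq
  · intro i ρ v hρ
    exact hρ
  · intro j hj
    omega
  · intro i hi ρ hf hx hρ
    have hL : I.Loaded ρ := h.of_eq (hf.reg _ rfl) (hf.reg _ rfl) (hf.arr _ rfl) (hf.arr _ rfl)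
      (hf.arr _ rfl) (hf.arr _ rfl) (hf.arr _ rfl)
    refine Runs.seq (runs_findAnchor hL hM ?_ ⟨i, hi⟩ hx) fun τ hf' ⟨u, hu, hu₁, hu₂, hu₃⟩ => ?_
    · simpa only [hf.arr 7 rfl, hf.arr 4 rfl] using hs
    refine Runs.of_straight rfl (by decide) ?_
    have h4 : τ.reg 4 = (i : ℕ) := by rw [hf'.reg 4 rfl, hx]
    have h0 : τ.reg 0 = (I.n : ℕ) := by rw [hf'.reg 0 rfl, hL.n_eq]
    have e1 : τ.arr 4 (u : ℕ) = I.bottleneck ⟨i, hi⟩ := by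
      rw [hf'.arr 4 rfl, hL.cap_eq, hu₃]
    have e2 : τ.arr 2 (i : ℕ) = I.demand ⟨i, hi⟩ := by
      rw [hf'.arr 2 rfl, ← hL.demand_eq]
    have hτ : I.Anchored τ i := by
      unfold Anchored
      rw [hf'.arr 8 rfl, hf'.arr 9 rfl, hf'.arr 10 rfl]
      exact hρ
    have hin : ((I.n : ℕ) : ℤ) ≠ (i : ℕ) := by
      exact_mod_cast hi.ne'
    have hin' := hin.symm
    intro j hj
    have hjn : ((j : ℕ) : ℤ) ≠ I.n := by exact_mod_cast j.isLt.ne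
    simp only [Cmd.run, Expr.eval, Test.Holds, h4, h0, hu, State.arr_setArr, State.reg_setArr,
      Nat.reduceEqDiff, if_true, if_false, Function.update_self, e1, e2,
      Function.update_of_ne hin]
    by_cases hji : (j : ℕ) = i
    · obtain rfl : j = ⟨i, hi⟩ := Fin.ext hji
      split_ifs with hc
      · simp only [State.arr_setArr, Nat.reduceEqDiff, if_true, if_false,
          Function.update_of_ne hin', Function.update_self, le_refl, and_true]
        exact ⟨u, rfl, hu₁, hu₂, hu₃⟩
      · simp only [State.arr_setArr, Nat.reduceEqDiff, if_true, if_false,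
          Function.update_of_ne hin, Function.update_self, true_and]
        exact ⟨⟨u, rfl, hu₁, hu₂, hu₃⟩, (not_le.1 hc).le⟩
    · obtain ⟨h₁, h₂, h₃, h₄⟩ := hτ j (by omega)
      have hji' : ((j : ℕ) : ℤ) ≠ (i : ℕ) := by exact_mod_cast hji
      split_ifs with hc
      · simp only [State.arr_setArr, Nat.reduceEqDiff, if_true, if_false,
          Function.update_of_ne hji', Function.update_of_ne hjn, Function.update_self]
        exact ⟨h₁, h₂, h₃, hc.trans h₄⟩
      · simp only [State.arr_setArr, Nat.reduceEqDiff, if_true, if_false,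
          Function.update_of_ne hji', Function.update_of_ne hin]
        exact ⟨h₁, h₂, h₃, h₄⟩

end UFPP

/-! ### The tables of the dynamic program -/

namespace UFPP

open RAM

variable {I : UFPP}

/-- The box data held in arrays `0`, `1`, `9`, `10` and `8`. -/
def boxes (σ : State) : Boxes where
  s := fun i => σ.arr 0 i
  t := fun i => σ.arr 1 i
  b := fun i => σ.arr 9 i
  y := fun i => σ.arr 10 i
  e := fun i => σ.arr 8 i

/-- Everything that the dynamic program reads and does not change: the boxes `D`, where box `n` is a
sentinel to the left of all tasks and box `n + 1` one to their right, the profits, and tables of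
multiples that replace the multiplications in the addressing of two- and three-dimensional tables
of side length `n + 2`. -/
structure Ready (I : UFPP) (D : Boxes) (σ : State) : Prop where
  n_eq : σ.reg 0 = I.n
  side_eq : σ.reg 2 = I.n + 2
  profit_eq : ∀ j : Fin I.n, σ.arr 3 (j : ℕ) = I.profit j
  boxes_eq : boxes σ = D
  encodes : I.Encodes D
  between : ∀ j : Fin I.n, D.Between I.n (I.n + 1) j
  row_eq : ∀ i : ℕ, i ≤ I.n + 2 → σ.arr 11 i = i * (I.n + 2)
  plane_eq : ∀ i : ℕ, i ≤ I.n + 2 → σ.arr 12 i = i * ((I.n + 2) * (I.n + 2))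

/-- The program does not write to the memory that `Ready` is about. -/
def keepsReady (p : Cmd) : Bool :=
  !p.writesReg 0 && !p.writesReg 2 && !p.writesArr 0 && !p.writesArr 1 && !p.writesArr 3 &&
    !p.writesArr 8 && !p.writesArr 9 && !p.writesArr 10 && !p.writesArr 11 && !p.writesArr 12

theorem Ready.of_frame {D : Boxes} {p : Cmd} {σ τ : State} (h : I.Ready D σ) (hf : Frame p σ τ)
    (hp : keepsReady p = true) : I.Ready D τ := by
  simp only [keepsReady, Bool.and_eq_true, Bool.not_eq_true'] at hp
  obtain ⟨⟨⟨⟨⟨⟨⟨⟨⟨r0, r2⟩, a0⟩, a1⟩, a3⟩, a8⟩, a9⟩, a10⟩, a11⟩, a12⟩ := hp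
  constructor
  · rw [hf.reg _ r0, h.n_eq]
  · rw [hf.reg _ r2, h.side_eq]
  · rw [hf.arr _ a3]; exact h.profit_eq
  · rw [← h.boxes_eq]
    simp only [boxes, hf.arr _ a0, hf.arr _ a1, hf.arr _ a8, hf.arr _ a9, hf.arr _ a10]
  · exact h.encodes
  · exact h.between
  · rw [hf.arr _ a11]; exact h.row_eq
  · rw [hf.arr _ a12]; exact h.plane_eq

/-- Appends the two sentinels to the boxes. Only the data that matters is set: the sentinels have no
upper ends, as they are separated from all tasks horizontally. -/
def addSentinels : Cmd :=
  .seq (.assign 2 (.add (.reg 0) (.const 2))) <|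
  .seq (.store 8 (.reg 0) (.const (-1))) <|
  .seq (.store 1 (.reg 0) (.const 0)) <|
  .seq (.store 8 (.add (.reg 0) (.const 1)) (.reg 1)) <|
  .seq (.store 0 (.add (.reg 0) (.const 1)) (.reg 1)) <|
  .store 10 (.add (.reg 0) (.const 1)) (.get 10 (.reg 0))

theorem runs_addSentinels {σ : State} (h : I.Loaded σ) (ha : I.Anchored σ I.n) :
    Runs addSentinels σ 40 fun τ => τ.reg 2 = I.n + 2 ∧ I.Encodes (boxes τ) ∧
      ∀ j : Fin I.n, (boxes τ).Between I.n (I.n + 1) j := by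
  refine Runs.of_straight rfl (by decide) ?_
  have hne : ∀ j : Fin I.n, ((j : ℕ) : ℤ) ≠ I.n := fun j => by exact_mod_cast j.isLt.ne
  have hne' : ∀ j : Fin I.n, ((j : ℕ) : ℤ) ≠ I.n + 1 := fun j => by
    exact_mod_cast (j.isLt.trans (Nat.lt_succ_self _)).ne
  have hnn : (I.n : ℤ) ≠ I.n + 1 := by omega
  have e0 := h.n_eq
  have e1 := h.m_eq
  set τ := addSentinels.run σ with hτ
  have hs : ∀ j : Fin I.n, (boxes τ).s j = (I.start j : ℕ) := by
    intro j
    simp [hτ, boxes, addSentinels, Cmd.run, Expr.eval, e0, e1, hne', h.start_eq]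
  have ht : ∀ j : Fin I.n, (boxes τ).t j = (I.finish j : ℕ) := by
    intro j
    simp [hτ, boxes, addSentinels, Cmd.run, Expr.eval, e0, e1, hne, h.finish_eq]
  have hb : ∀ j : Fin I.n, (boxes τ).b j = I.bottleneck j := by
    intro j
    simp [hτ, boxes, addSentinels, Cmd.run, Expr.eval, e0, e1, (ha j j.isLt).2.1]
  have hy : ∀ j : Fin I.n, (boxes τ).y j = (I.bottleneck j : ℤ) - I.demand j := by
    intro j
    simp [hτ, boxes, addSentinels, Cmd.run, Expr.eval, e0, e1, hne', (ha j j.isLt).2.2.1]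
  have he : ∀ j : Fin I.n, (boxes τ).e j = σ.arr 8 (j : ℕ) := by
    intro j
    simp [hτ, boxes, addSentinels, Cmd.run, Expr.eval, e0, e1, hne, hne']
  refine ⟨?_, ⟨hs, ht, hb, hy, fun j => ?_, fun j => ?_, fun i j h₁ h₂ => ?_⟩, fun j => ?_⟩
  · simp [hτ, addSentinels, Cmd.run, Expr.eval, e0]
  · obtain ⟨⟨u, hu, h₁, h₂, h₃⟩, -⟩ := ha j j.isLt
    rw [hs, he, hu]
    exact_mod_cast h₁
  · obtain ⟨⟨u, hu, h₁, h₂, h₃⟩, -⟩ := ha j j.isLt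
    rw [ht, he, hu]
    exact_mod_cast h₂
  · obtain ⟨⟨u, hu, -, -, h₃⟩, -⟩ := ha i i.isLt
    rw [he, hu, hs] at h₁
    rw [he, hu, ht] at h₂
    rw [hb, hb, ← h₃]
    exact_mod_cast bottleneck_le (by exact_mod_cast h₁) (by exact_mod_cast h₂)
  · have y₁ : (boxes τ).y I.n = σ.arr 10 I.n := by
      simp [hτ, boxes, addSentinels, Cmd.run, Expr.eval, e0, e1, hnn]
    have y₂ : (boxes τ).y (I.n + 1) = σ.arr 10 I.n := by
      simp [hτ, boxes, addSentinels, Cmd.run, Expr.eval, e0, e1]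
    have t₁ : (boxes τ).t I.n = 0 := by
      simp [hτ, boxes, addSentinels, Cmd.run, Expr.eval, e0, e1]
    have s₂ : (boxes τ).s (I.n + 1) = I.m := by
      simp [hτ, boxes, addSentinels, Cmd.run, Expr.eval, e0, e1]
    have e₁ : (boxes τ).e I.n = -1 := by
      simp [hτ, boxes, addSentinels, Cmd.run, Expr.eval, e0, e1, hnn]
    have e₂ : (boxes τ).e (I.n + 1) = I.m := by
      simp [hτ, boxes, addSentinels, Cmd.run, Expr.eval, e0, e1]
    have hy' := (ha j j.isLt).2.2
    have hfin : (I.finish j : ℕ) < I.m + 1 := (I.finish j).isLt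
    unfold Boxes.Between
    rw [y₁, y₂, t₁, s₂, e₁, e₂, hs, ht, hy]
    omega

/-- Fills array `a` with the multiples of the number given by `step`. -/
def fillMultiples (a : ℕ) (step : Expr) : Cmd :=
  forLoop 3 2 (.store a (.add (.reg 3) (.const 1)) (.add (.get a (.reg 3)) step))

theorem runs_fillMultiples {σ : State} {a : ℕ} {step : Expr} {N : ℕ} {c : ℤ}
    (hN : σ.reg 2 = N) (h0 : σ.arr a 0 = 0)
    (hc : ∀ τ, Frame (fillMultiples a step) σ τ → step.eval τ = c) :
    Runs (fillMultiples a step) σ (N * (step.cost + 7 + 9) + 7)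
      fun τ => ∀ i : ℕ, i ≤ N → τ.arr a i = i * c := by
  refine Runs.forLoop (n := N) (T := step.cost + 7) (fun i ρ => ∀ k : ℕ, k ≤ i → ρ.arr a k = k * c)
    hN rfl rfl ?_ ?_ ?_
  · intro i ρ v hρ
    simpa using hρ
  · intro k hk
    obtain rfl : k = 0 := by omega
    simpa using h0
  · intro i hi ρ hf hx hρ
    refine Runs.of_straight rfl (by simp only [Cmd.cost, Expr.cost]; omega) fun k hk => ?_
    simp only [Cmd.run, Expr.eval, hx, hρ i le_rfl, hc ρ hf, State.arr_setArr, if_true,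
      Function.update_apply]
    split_ifs with hki
    · rw [hki]; ring
    · have : k ≠ i + 1 := by exact_mod_cast hki
      exact hρ k (by omega)

/-- The position of entry `(i, k)` in array `13`. -/
def valuePos (n i k : ℕ) : ℕ := i * (n + 2) + k

/-- The position of entry `(i, k, l)` in array `14`. -/
def memberPos (n i k l : ℕ) : ℕ := valuePos n i k * (n + 2) + l

theorem mul_add_inj {N i k i' k' : ℕ} (hk : k < N) (hk' : k' < N) :
    i * N + k = i' * N + k' ↔ i = i' ∧ k = k' := by
  constructor
  · intro h
    have h₁ := congrArg (· / N) h
    have h₂ := congrArg (· % N) h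
    have hN : 0 < N := by omega
    simp only [Nat.mul_comm _ N, Nat.mul_add_div hN, Nat.mul_add_mod, Nat.mod_eq_of_lt hk,
      Nat.mod_eq_of_lt hk', Nat.div_eq_of_lt hk, Nat.div_eq_of_lt hk', Nat.add_zero] at h₁ h₂
    exact ⟨h₁, h₂⟩
  · rintro ⟨rfl, rfl⟩
    rfl

theorem valuePos_inj {n i k i' k' : ℕ} (hk : k < n + 2) (hk' : k' < n + 2) :
    valuePos n i k = valuePos n i' k' ↔ i = i' ∧ k = k' :=
  mul_add_inj hk hk'

theorem memberPos_inj {n i k l i' k' l' : ℕ} (hk : k < n + 2) (hk' : k' < n + 2) (hl : l < n)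
    (hl' : l' < n) :
    memberPos n i k l = memberPos n i' k' l' ↔ (i = i' ∧ k = k') ∧ l = l' := by
  rw [memberPos, memberPos, mul_add_inj (by omega) (by omega), valuePos_inj hk hk']

theorem Ready.valuePos_eq {D : Boxes} {σ : State} (h : I.Ready D σ) {i : ℕ} (hi : i < I.n + 2)
    (k : ℕ) : σ.arr 11 i + k = (valuePos I.n i k : ℕ) := by
  rw [h.row_eq i hi.le, valuePos]
  push_cast
  rfl

theorem Ready.memberPos_eq {D : Boxes} {σ : State} (h : I.Ready D σ) {i k : ℕ} (hi : i < I.n + 2)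
    (hk : k < I.n + 2) (l : ℕ) :
    σ.arr 12 i + σ.arr 11 k + l = (memberPos I.n i k l : ℕ) := by
  rw [h.row_eq k hk.le, h.plane_eq i hi.le, memberPos, valuePos]
  push_cast
  ring

/-- Entry `(i, k)` of the tables describes an independent task set `F` between `i` and `k`: array
`13` holds its profit, and array `14` its characteristic vector. Moreover, `F` is optimal if there
are fewer than `r` tasks between `i` and `k`; the number `r` is called the rank of the entry. -/
def Cell (I : UFPP) (D : Boxes) (σ : State) (i k r : ℕ) : Prop :=
  ∃ F : Finset (Fin I.n), F ⊆ I.between D i k ∧ I.IsITS F ∧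
    σ.arr 13 (valuePos I.n i k) = I.totalProfit F ∧
    (∀ l : Fin I.n, σ.arr 14 (memberPos I.n i k l) = if l ∈ F then 1 else 0) ∧
    ((I.between D i k).card < r →
      ∀ G ⊆ I.between D i k, I.IsITS G → I.totalProfit G ≤ I.totalProfit F)

theorem Cell.mono {D : Boxes} {σ : State} {i k r r' : ℕ} (h : I.Cell D σ i k r) (hr : r' ≤ r) :
    I.Cell D σ i k r' := by
  obtain ⟨F, h₁, h₂, h₃, h₄, h₅⟩ := h
  exact ⟨F, h₁, h₂, h₃, h₄, fun hc => h₅ (by omega)⟩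

theorem Cell.congr {D : Boxes} {σ τ : State} {i k r : ℕ} (h : I.Cell D σ i k r)
    (hv : τ.arr 13 (valuePos I.n i k) = σ.arr 13 (valuePos I.n i k))
    (hm : ∀ l : Fin I.n, τ.arr 14 (memberPos I.n i k l) = σ.arr 14 (memberPos I.n i k l)) :
    I.Cell D τ i k r := by
  obtain ⟨F, h₁, h₂, h₃, h₄, h₅⟩ := h
  exact ⟨F, h₁, h₂, hv.trans h₃, fun l => (hm l).trans (h₄ l), h₅⟩

theorem cell_zero {D : Boxes} {σ : State} (h13 : ∀ x, σ.arr 13 x = 0) (h14 : ∀ x, σ.arr 14 x = 0)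
    (i k : ℕ) : I.Cell D σ i k 0 :=
  ⟨∅, by simp, by simp [IsITS], by simp [h13, totalProfit], by simp [h14], by omega⟩

/-! ### Improving one table entry -/

/-- The value of the candidate solution for the entry `(i, k)` that is put together from task `j`
and the entries `(i, j)` and `(j, k)`. -/
def candidate (n : ℕ) (σ : State) (i k j : ℕ) : ℤ :=
  σ.arr 13 (valuePos n i j) + σ.arr 3 j + σ.arr 13 (valuePos n j k)

/-- The address of the entry of array `13` with the given indices. -/
abbrev valueAddr (i k : Expr) : Expr := .add (.get 11 i) k

/-- The address of the entry of array `14` with the given indices. -/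
abbrev memberAddr (i k l : Expr) : Expr := .add (.add (.get 12 i) (.get 11 k)) l

/-- Tests whether box `j` is between boxes `i` and `k`, where `i`, `k`, `j` are the contents of
registers `4`, `5`, `6`. -/
def betweenTest : Test :=
  .and (.not (.le (.get 0 (.reg 6)) (.get 8 (.reg 4)))) <|
  .and (.le (.get 1 (.reg 6)) (.get 8 (.reg 5))) <|
  .and (.le (.get 10 (.reg 4)) (.get 10 (.reg 6))) <|
  .and (.le (.get 10 (.reg 5)) (.get 10 (.reg 6))) <|
  .and (.not (.and (.not (.le (.get 1 (.reg 4)) (.get 0 (.reg 6))))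
    (.not (.le (.get 9 (.reg 4)) (.get 10 (.reg 6)))))) <|
  .not (.and (.not (.le (.get 1 (.reg 6)) (.get 0 (.reg 5))))
    (.not (.le (.get 9 (.reg 5)) (.get 10 (.reg 6)))))

theorem holds_betweenTest {σ : State} {i k j : ℕ} (h4 : σ.reg 4 = i) (h5 : σ.reg 5 = k)
    (h6 : σ.reg 6 = j) : betweenTest.Holds σ ↔ (boxes σ).Between i k j := by
  simp only [betweenTest, Test.Holds, Expr.eval, h4, h5, h6, Boxes.Between, boxes]
  omega

/-- Puts the value of the best solution known for entry `(i, k)` into register `7`, and into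
register `8` the task `j` from which the candidate with this value is put together, or `-1` if it is
the current entry. -/
def selectTask : Cmd :=
  .seq (.seq (.assign 7 (.get 13 (valueAddr (.reg 4) (.reg 5)))) (.assign 8 (.const (-1)))) <|
  forLoop 6 0 <|
    .cond (.and betweenTest (.not (.le
        (.add (.add (.get 13 (valueAddr (.reg 4) (.reg 6))) (.get 3 (.reg 6)))
          (.get 13 (valueAddr (.reg 6) (.reg 5)))) (.reg 7))))
      (.seq
        (.assign 7 (.add (.add (.get 13 (valueAddr (.reg 4) (.reg 6))) (.get 3 (.reg 6)))
          (.get 13 (valueAddr (.reg 6) (.reg 5)))))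
        (.assign 8 (.reg 6)))
      .skip

theorem runs_selectTask {D : Boxes} {σ : State} (h : I.Ready D σ) {i k : ℕ} (hi : i < I.n + 2)
    (h4 : σ.reg 4 = i) (h5 : σ.reg 5 = k) :
    Runs selectTask σ (20 + (I.n * (100 + 9) + 7)) fun τ =>
      ((τ.reg 8 = -1 ∧ τ.reg 7 = σ.arr 13 (valuePos I.n i k)) ∨
        ∃ j : Fin I.n, τ.reg 8 = (j : ℕ) ∧ D.Between i k j ∧ τ.reg 7 = candidate I.n σ i k j) ∧
      ∀ j : Fin I.n, D.Between i k j → candidate I.n σ i k j ≤ τ.reg 7 := by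
  refine Runs.seq (P := fun τ => τ.reg 7 = σ.arr 13 (valuePos I.n i k) ∧ τ.reg 8 = -1)
    (Runs.of_straight rfl (by decide) ?_) fun τ hf hτ => ?_
  · simp [Cmd.run, Expr.eval, h4, h5, h.valuePos_eq hi]
  refine (Runs.forLoop (n := I.n) (T := 100) (fun x ρ =>
      ((ρ.reg 8 = -1 ∧ ρ.reg 7 = σ.arr 13 (valuePos I.n i k)) ∨
        ∃ j : Fin I.n, ρ.reg 8 = (j : ℕ) ∧ D.Between i k j ∧ ρ.reg 7 = candidate I.n σ i k j) ∧
      ∀ j : Fin I.n, (j : ℕ) < x → D.Between i k j → candidate I.n σ i k j ≤ ρ.reg 7)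
    ?_ rfl rfl ?_ ?_ ?_).mono le_rfl ?_
  · rw [hf.reg 0 rfl, h.n_eq]
  · intro x ρ v hρ
    simpa using hρ
  · exact ⟨Or.inl ⟨hτ.2, hτ.1⟩, fun j hj => by omega⟩
  · intro x hxn ρ hf' hx hρ
    refine Runs.of_straight rfl (by decide) ?_
    have hR : I.Ready D ρ := (h.of_frame hf rfl).of_frame hf' rfl
    have r4 : ρ.reg 4 = i := by rw [hf'.reg 4 rfl, hf.reg 4 rfl, h4]
    have r5 : ρ.reg 5 = k := by rw [hf'.reg 5 rfl, hf.reg 5 rfl, h5]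
    have hc : ρ.arr 13 (valuePos I.n i x) + ρ.arr 3 x + ρ.arr 13 (valuePos I.n x k) =
        candidate I.n σ i k x := by
      rw [hf'.arr 13 rfl, hf.arr 13 rfl, hf'.arr 3 rfl, hf.arr 3 rfl, candidate]
    have hx' : x < I.n + 2 := by omega
    obtain ⟨hρ₁, hρ₂⟩ := hρ
    rw [Cmd.run]
    split_ifs with hb <;>
      simp only [Test.Holds, holds_betweenTest r4 r5 hx, Expr.eval, r4, r5, hx,
        hR.valuePos_eq hi, hR.valuePos_eq hx', hc, hR.boxes_eq] at hb
    · obtain ⟨hb₁, hb₂⟩ := hb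
      rw [not_le] at hb₂
      simp only [Cmd.run, Expr.eval, r4, r5, hx, hR.valuePos_eq hi, hR.valuePos_eq hx', hc,
        State.reg_setReg, Nat.reduceEqDiff, if_true, if_false]
      refine ⟨Or.inr ⟨⟨x, hxn⟩, rfl, hb₁, rfl⟩, fun j hj hj' => ?_⟩
      by_cases hjx : (j : ℕ) = x
      · rw [hjx]
      · exact (hρ₂ j (by omega) hj').trans hb₂.le
    · refine ⟨hρ₁, fun j hj hj' => ?_⟩
      by_cases hjx : (j : ℕ) = x
      · rw [hjx] at hj' ⊢
        by_contra hc'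
        exact hb ⟨hj', hc'⟩
      · exact hρ₂ j (by omega) hj'
  · rintro ρ - ⟨h₁, h₂⟩
    exact ⟨h₁, fun j => h₂ j j.isLt⟩

/-- Makes row `(i, k)` of array `14` the characteristic vector of the union of the sets in rows
`(i, j)` and `(j, k)` and the set `{j}`, where `j` is the content of register `8`. -/
def copySolution : Cmd :=
  forLoop 6 0 <|
    .cond (.eq (.reg 6) (.reg 8))
      (.store 14 (memberAddr (.reg 4) (.reg 5) (.reg 6)) (.const 1))
      (.store 14 (memberAddr (.reg 4) (.reg 5) (.reg 6))
        (.add (.get 14 (memberAddr (.reg 4) (.reg 8) (.reg 6)))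
          (.get 14 (memberAddr (.reg 8) (.reg 5) (.reg 6)))))

theorem runs_copySolution {D : Boxes} {σ : State} (h : I.Ready D σ) {i k : ℕ} {j : Fin I.n}
    (hi : i < I.n + 2) (hk : k < I.n + 2) (hj : D.Between i k j) (h4 : σ.reg 4 = i)
    (h5 : σ.reg 5 = k) (h8 : σ.reg 8 = (j : ℕ)) :
    Runs copySolution σ (I.n * (40 + 9) + 7) fun τ =>
      ∀ i' k' : ℕ, k' < I.n + 2 → ∀ l : Fin I.n, τ.arr 14 (memberPos I.n i' k' l) =
        if i' = i ∧ k' = k then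
          if l = j then 1 else σ.arr 14 (memberPos I.n i j l) + σ.arr 14 (memberPos I.n j k l)
        else σ.arr 14 (memberPos I.n i' k' l) := by
  have hjn : (j : ℕ) < I.n + 2 := by omega
  refine (Runs.forLoop (n := I.n) (T := 40) (fun x ρ =>
      ∀ i' k' : ℕ, k' < I.n + 2 → ∀ l : Fin I.n, ρ.arr 14 (memberPos I.n i' k' l) =
        if (i' = i ∧ k' = k) ∧ (l : ℕ) < x then
          if l = j then 1 else σ.arr 14 (memberPos I.n i j l) + σ.arr 14 (memberPos I.n j k l)
        else σ.arr 14 (memberPos I.n i' k' l)) ?_ rfl rfl ?_ ?_ ?_).mono le_rfl ?_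
  · rw [h.n_eq]
  · intro x ρ v hρ
    simpa using hρ
  · intro i' k' hk' l
    simp
  · intro x hxn ρ hf hx hρ
    refine Runs.of_straight rfl (by decide) ?_
    have hR : I.Ready D ρ := h.of_frame hf rfl
    have r4 : ρ.reg 4 = i := by rw [hf.reg 4 rfl, h4]
    have r5 : ρ.reg 5 = k := by rw [hf.reg 5 rfl, h5]
    have r8 : ρ.reg 8 = (j : ℕ) := by rw [hf.reg 8 rfl, h8]
    -- The rows that are read are different from the row that is written.
    have e₁ := hρ i j hjn ⟨x, hxn⟩
    have e₂ := hρ j k hk ⟨x, hxn⟩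
    rw [if_neg (fun hc => h.encodes.ne_right hj hc.1.2)] at e₁
    rw [if_neg (fun hc => h.encodes.ne_left hj hc.1.1)] at e₂
    simp only at e₁ e₂
    have hrun : ∃ c, c = (if (⟨x, hxn⟩ : Fin I.n) = j then 1 else
        σ.arr 14 (memberPos I.n i j x) + σ.arr 14 (memberPos I.n j k x)) ∧
        Cmd.run (.cond (.eq (.reg 6) (.reg 8))
          (.store 14 (memberAddr (.reg 4) (.reg 5) (.reg 6)) (.const 1))
          (.store 14 (memberAddr (.reg 4) (.reg 5) (.reg 6))
            (.add (.get 14 (memberAddr (.reg 4) (.reg 8) (.reg 6)))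
              (.get 14 (memberAddr (.reg 8) (.reg 5) (.reg 6)))))) ρ =
        ρ.setArr 14 (memberPos I.n i k x) c := by
      refine ⟨_, rfl, ?_⟩
      simp only [Cmd.run, Test.Holds, Expr.eval, r4, r5, r8, hx, hR.memberPos_eq hi hk,
        hR.memberPos_eq hi hjn, hR.memberPos_eq hjn hk, e₁, e₂, Fin.ext_iff, Nat.cast_inj]
      split_ifs <;> rfl
    obtain ⟨c, hc, hrun⟩ := hrun
    rw [hrun]
    intro i' k' hk' l
    simp only [State.arr_setArr, if_true, Function.update_apply, Nat.cast_inj,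
      memberPos_inj hk' hk l.isLt hxn]
    rw [hρ i' k' hk' l]
    by_cases hik : i' = i ∧ k' = k
    · by_cases hlx : (l : ℕ) = x
      · obtain rfl : l = ⟨x, hxn⟩ := Fin.ext hlx
        simp [hik, hc]
      · have : (l : ℕ) < x + 1 ↔ (l : ℕ) < x := by omega
        simp [hik, hlx, this]
    · simp [hik]
  · intro ρ _ hρ i' k' hk' l
    simpa using hρ i' k' hk' l

/-- Replaces the entry `(i, k)` by the best candidate if that is better. -/
def updateCell : Cmd :=
  .seq selectTask <|
  .cond (.le (.const 0) (.reg 8))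
    (.seq (.store 13 (valueAddr (.reg 4) (.reg 5)) (.reg 7)) copySolution) .skip

/-- If all entries have rank `r`, then an update gives rank `r + 1` to an entry `(i, k)`, because
the entries `(i, j)` and `(j, k)` that it is put together from concern fewer tasks. -/
theorem runs_updateCell {D : Boxes} {σ : State} (h : I.Ready D σ) {i k : ℕ} (hi : i < I.n + 2)
    (hk : k < I.n + 2) (h4 : σ.reg 4 = i) (h5 : σ.reg 5 = k) {r : ℕ} {ρ : ℕ → ℕ → ℕ}
    (hρ : ∀ i' k', r ≤ ρ i' k')
    (hcell : ∀ i' k', i' < I.n + 2 → k' < I.n + 2 → I.Cell D σ i' k' (ρ i' k')) :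
    Runs updateCell σ (20 + (I.n * (100 + 9) + 7) + (4 + (6 + (I.n * (40 + 9) + 7)))) fun τ =>
      ∀ i' k', i' < I.n + 2 → k' < I.n + 2 →
        I.Cell D τ i' k' (if i' = i ∧ k' = k then r + 1 else ρ i' k') := by
  refine Runs.seq (runs_selectTask h hi h4 h5) fun τ hf ⟨hτ₁, hτ₂⟩ => ?_
  -- The candidates bound the profit of every solution.
  have hopt : ∀ v : ℤ, 0 ≤ v → (∀ j : Fin I.n, D.Between i k j → candidate I.n σ i k j ≤ v) →
      (I.between D i k).card < r + 1 → ∀ G ⊆ I.between D i k, I.IsITS G →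
      (I.totalProfit G : ℤ) ≤ v := by
    intro v hv hcand hcard G hG hG'
    rcases G.eq_empty_or_nonempty with rfl | hne
    · simpa [totalProfit] using hv
    obtain ⟨j, hj, A, B, hA, hB, hA', hB', hsum⟩ := h.encodes.exists_split hG' hG hne
    obtain ⟨F₁, -, -, v₁, -, o₁⟩ := hcell i j hi (by omega)
    obtain ⟨F₂, -, -, v₂, -, o₂⟩ := hcell j k (by omega) hk
    have l₁ := h.encodes.card_left_lt hj
    have l₂ := h.encodes.card_right_lt hj
    have p₁ := o₁ (by have := hρ i j; omega) A hA hA'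
    have p₂ := o₂ (by have := hρ j k; omega) B hB hB'
    refine le_trans ?_ (hcand j hj)
    rw [candidate, v₁, v₂, h.profit_eq, hsum]
    push_cast
    omega
  have r4 : τ.reg 4 = i := by rw [hf.reg 4 rfl, h4]
  have r5 : τ.reg 5 = k := by rw [hf.reg 5 rfl, h5]
  have hR : I.Ready D τ := h.of_frame hf rfl
  have hcell' : ∀ i' k', i' < I.n + 2 → k' < I.n + 2 → I.Cell D τ i' k' (ρ i' k') :=
    fun i' k' hi' hk' => (hcell i' k' hi' hk').congr (by rw [hf.arr 13 rfl])
      fun l => by rw [hf.arr 14 rfl]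
  refine Runs.cond (fun hb => ?_) (fun hb => ?_)
  · simp only [Test.Holds, Expr.eval] at hb
    obtain ⟨h8, -⟩ | ⟨j, h8, hj, h7⟩ := hτ₁
    · omega
    refine Runs.seq (P := fun τ' => τ'.arr 13 =
        Function.update (τ.arr 13) (valuePos I.n i k) (candidate I.n σ i k j))
      (Runs.of_straight rfl (by decide) ?_) fun τ' hf' hτ' => ?_
    · simp [Cmd.run, Expr.eval, r4, r5, hR.valuePos_eq hi, h7]
    have hR' : I.Ready D τ' := hR.of_frame hf' rfl
    refine (runs_copySolution hR' hi hk hj (by rw [hf'.reg 4 rfl, r4])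
      (by rw [hf'.reg 5 rfl, r5]) (by rw [hf'.reg 8 rfl, h8])).mono le_rfl fun ω hfω hω => ?_
    intro i' k' hi' hk'
    have hω13 : ω.arr 13 = τ'.arr 13 := hfω.arr 13 rfl
    have hτ14 : τ'.arr 14 = τ.arr 14 := hf'.arr 14 rfl
    by_cases hik : i' = i ∧ k' = k
    · rw [if_pos hik]
      obtain ⟨rfl, rfl⟩ := hik
      obtain ⟨A, hA, hA', vA, mA, -⟩ := hcell' i' j hi (by omega)
      obtain ⟨B, hB, hB', vB, mB, -⟩ := hcell' j k' (by omega) hk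
      have hval : candidate I.n σ i' k' j = I.totalProfit (insert j (A ∪ B)) := by
        rw [h.encodes.totalProfit_insert hA hB, candidate, ← hf.arr 13 rfl, vA, vB, h.profit_eq]
        push_cast
        rfl
      refine ⟨insert j (A ∪ B), h.encodes.insert_subset hj hA hB,
        h.encodes.isITS_insert hA hB hA' hB', ?_, fun l => ?_, fun hcard G hG hG' => ?_⟩
      · rw [hω13, hτ', Function.update_self, hval]
      · rw [hω i' k' hk l, if_pos ⟨rfl, rfl⟩, hτ14, mA, mB]
        have hdis : l ∈ A → l ∉ B := fun hl => Finset.disjoint_left.1 (h.encodes.disjoint hA hB) hl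
        by_cases hl : l = j
        · simp [hl]
        · by_cases hlA : l ∈ A
          · simp [hl, hlA, hdis hlA]
          · simp [hl, hlA]
      · have := hopt _ (by rw [h7, hval]; positivity) hτ₂ hcard G hG hG'
        rw [h7, hval] at this
        exact_mod_cast this
    · rw [if_neg hik]
      refine (hcell' i' k' hi' hk').congr ?_ fun l => ?_
      · rw [hω13, hτ', Function.update_of_ne]
        rw [Ne, Nat.cast_inj, valuePos_inj hk' hk]
        exact hik
      · rw [hω i' k' hk' l, if_neg hik, hτ14]
  · simp only [Test.Holds, Expr.eval] at hb
    obtain ⟨h8, h7⟩ | ⟨j, h8, -, -⟩ := hτ₁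
    swap
    · omega
    refine Runs.of_straight rfl (by simp only [Cmd.cost]; omega) fun i' k' hi' hk' => ?_
    simp only [Cmd.run]
    by_cases hik : i' = i ∧ k' = k
    · rw [if_pos hik]
      obtain ⟨rfl, rfl⟩ := hik
      obtain ⟨F, hF, hF', vF, mF, -⟩ := hcell' i' k' hi hk
      refine ⟨F, hF, hF', vF, mF, fun hcard G hG hG' => ?_⟩
      have h7' : τ.reg 7 = I.totalProfit F := by rw [h7, ← vF, hf.arr 13 rfl]
      have := hopt _ (by rw [h7']; positivity) hτ₂ hcard G hG hG'
      rw [h7'] at this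
      exact_mod_cast this
    · rw [if_neg hik]
      exact hcell' i' k' hi' hk'

end UFPP

/-! ### The algorithm -/

namespace UFPP

open RAM

variable {I : UFPP}

/-- Computes everything that the dynamic program reads. -/
def prepare : Cmd :=
  .seq markFinishes <| .seq scanSegments <| .seq findAnchors <| .seq addSentinels <|
  .seq (fillMultiples 11 (.reg 2)) (fillMultiples 12 (.get 11 (.reg 2)))

theorem runs_prepare (I : UFPP) :
    Runs prepare I.input (3 + (I.n * (4 + 9) + 7) + (I.m * (40 + 9) + 7 +
      (I.n * (4 + (I.n * (40 + 9) + 7) + 40 + 9) + 7 + (40 +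
        ((I.n + 2) * (1 + 7 + 9) + 7 + ((I.n + 2) * (2 + 7 + 9) + 7))))))
      fun τ => I.Ready (boxes τ) τ := by
  have h₀ := loaded_input (I := I)
  refine Runs.seq (runs_markFinishes h₀ fun _ => rfl) fun σ₁ f₁ h₁ => ?_
  have L₁ : I.Loaded σ₁ := h₀.of_eq (f₁.reg _ rfl) (f₁.reg _ rfl) (f₁.arr _ rfl) (f₁.arr _ rfl)
    (f₁.arr _ rfl) (f₁.arr _ rfl) (f₁.arr _ rfl)
  refine Runs.seq (runs_scanSegments L₁ ((h₁ _).2 (Or.inl rfl))) fun σ₂ f₂ h₂ => ?_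
  have L₂ : I.Loaded σ₂ := L₁.of_eq (f₂.reg _ rfl) (f₂.reg _ rfl) (f₂.arr _ rfl) (f₂.arr _ rfl)
    (f₂.arr _ rfl) (f₂.arr _ rfl) (f₂.arr _ rfl)
  rw [← f₂.arr 4 rfl] at h₂
  refine Runs.seq (runs_findAnchors L₂ (fun x => ?_) h₂) fun σ₃ f₃ h₃ => ?_
  · rw [h₁]
    simp only [Nat.cast_inj]
  have L₃ : I.Loaded σ₃ := L₂.of_eq (f₃.reg _ rfl) (f₃.reg _ rfl) (f₃.arr _ rfl) (f₃.arr _ rfl)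
    (f₃.arr _ rfl) (f₃.arr _ rfl) (f₃.arr _ rfl)
  refine Runs.seq (runs_addSentinels L₃ h₃) fun σ₄ f₄ ⟨hN, henc, hbet⟩ => ?_
  have hz : ∀ a, (a = 11 ∨ a = 12) → σ₄.arr a 0 = 0 := by
    rintro a (rfl | rfl) <;>
    · rw [f₄.arr _ rfl, f₃.arr _ rfl, f₂.arr _ rfl, f₁.arr _ rfl]
      rfl
  refine Runs.seq (runs_fillMultiples (N := I.n + 2) (c := I.n + 2) (by rw [hN]; push_cast; rfl)
    (hz _ (Or.inl rfl)) fun τ hf => by rw [Expr.eval, hf.reg 2 rfl, hN]) fun σ₅ f₅ h₅ => ?_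
  have hN₅ : σ₅.reg 2 = ((I.n + 2 : ℕ) : ℤ) := by
    rw [f₅.reg 2 rfl, hN]; push_cast; rfl
  refine (runs_fillMultiples (N := I.n + 2) (c := (I.n + 2) * (I.n + 2)) hN₅
    (by rw [f₅.arr 12 rfl]; exact hz _ (Or.inr rfl)) fun τ hf => ?_).mono le_rfl fun σ₆ f₆ h₆ => ?_
  · rw [Expr.eval, Expr.eval, hf.reg 2 rfl, hN₅, hf.arr 11 rfl, h₅ _ le_rfl]
    push_cast
    rfl
  have hbox : boxes σ₆ = boxes σ₄ := by
    simp only [boxes, f₆.arr 0 rfl, f₅.arr 0 rfl, f₆.arr 1 rfl, f₅.arr 1 rfl, f₆.arr 8 rfl,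
      f₅.arr 8 rfl, f₆.arr 9 rfl, f₅.arr 9 rfl, f₆.arr 10 rfl, f₅.arr 10 rfl]
  constructor
  · rw [f₆.reg 0 rfl, f₅.reg 0 rfl, f₄.reg 0 rfl, L₃.n_eq]
  · rw [f₆.reg 2 rfl, hN₅]; push_cast; rfl
  · rw [f₆.arr 3 rfl, f₅.arr 3 rfl, f₄.arr 3 rfl]; exact L₃.profit_eq
  · rfl
  · rw [hbox]; exact henc
  · rw [hbox]; exact hbet
  · rw [f₆.arr 11 rfl]; exact h₅
  · exact h₆

/-- Updates all entries `n + 2` times. -/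
def improve : Cmd := forLoop 3 2 <| forLoop 4 2 <| forLoop 5 2 updateCell

/-- Each entry `(i, k)` of the tables is valid and has rank `ρ i k`. -/
def Table (I : UFPP) (D : Boxes) (σ : State) (ρ : ℕ → ℕ → ℕ) : Prop :=
  ∀ i k, i < I.n + 2 → k < I.n + 2 → I.Cell D σ i k (ρ i k)

theorem Table.mono {D : Boxes} {σ : State} {ρ ρ' : ℕ → ℕ → ℕ} (h : I.Table D σ ρ)
    (hρ : ∀ i k, i < I.n + 2 → k < I.n + 2 → ρ' i k ≤ ρ i k) : I.Table D σ ρ' :=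
  fun i k hi hk => (h i k hi hk).mono (hρ i k hi hk)

theorem runs_improve {D : Boxes} {σ : State} (h : I.Ready D σ) (hT : I.Table D σ fun _ _ => 0) :
    Runs improve σ ((I.n + 2) * ((I.n + 2) * ((I.n + 2) *
      (20 + (I.n * (100 + 9) + 7) + (4 + (6 + (I.n * (40 + 9) + 7))) + 9) + 7 + 9) + 7 + 9) + 7)
      fun τ => I.Table D τ fun _ _ => I.n + 2 := by
  have hN : ∀ τ, I.Ready D τ → τ.reg 2 = ((I.n + 2 : ℕ) : ℤ) := fun τ hτ => by
    rw [hτ.side_eq]; push_cast; rfl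
  refine Runs.forLoop (fun r τ => I.Table D τ fun _ _ => r) (hN σ h) rfl rfl
    (fun _ _ _ h => h) hT fun r hr τ₁ f₁ x₁ h₁ => ?_
  have R₁ : I.Ready D τ₁ := h.of_frame f₁ rfl
  refine (Runs.forLoop (fun i τ => I.Table D τ fun i' _ => if i' < i then r + 1 else r) (hN _ R₁)
    rfl rfl (fun _ _ _ h => h) (h₁.mono fun i k _ _ => by simp) fun i hi τ₂ f₂ x₂ h₂ => ?_).mono
    le_rfl fun τ _ hτ => hτ.mono fun i k hi _ => by simp [hi]
  have R₂ : I.Ready D τ₂ := R₁.of_frame f₂ rfl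
  refine (Runs.forLoop (fun k τ => I.Table D τ
    fun i' k' => if i' < i ∨ i' = i ∧ k' < k then r + 1 else r) (hN _ R₂)
    rfl rfl (fun _ _ _ h => h) (h₂.mono fun i k _ _ => by simp) fun k hk τ₃ f₃ x₃ h₃ => ?_).mono
    le_rfl fun τ _ hτ => hτ.mono fun i' k' _ hk' => ?_
  · have R₃ : I.Ready D τ₃ := R₂.of_frame f₃ rfl
    refine (runs_updateCell R₃ hi hk (by rw [f₃.reg 4 rfl, x₂]) x₃ (r := r) (fun i' k' => ?_)
      h₃).mono le_rfl fun τ _ hτ => Table.mono hτ fun i' k' _ _ => ?_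
    · split_ifs <;> omega
    · split_ifs <;> omega
  · split_ifs <;> omega

/-- Copies the solution of the entry for the two sentinels to the output. -/
def writeOutput : Cmd :=
  forLoop 6 0 <|
    .store 5 (.reg 6) (.get 14 (memberAddr (.reg 0) (.add (.reg 0) (.const 1)) (.reg 6)))

theorem runs_writeOutput {D : Boxes} {σ : State} (h : I.Ready D σ) :
    Runs writeOutput σ (I.n * (40 + 9) + 7) fun τ => ∀ l : Fin I.n,
      τ.arr 5 (l : ℕ) = σ.arr 14 (memberPos I.n I.n (I.n + 1) l) := by
  refine (Runs.forLoop (n := I.n) (T := 40) (fun x τ => ∀ l : Fin I.n, (l : ℕ) < x →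
    τ.arr 5 (l : ℕ) = σ.arr 14 (memberPos I.n I.n (I.n + 1) l)) h.n_eq rfl rfl
    (fun _ _ _ h => h) (fun l hl => by omega) fun x hxn τ f hx hτ => ?_).mono le_rfl
    fun τ _ hτ l => hτ l l.isLt
  refine Runs.of_straight rfl (by decide) fun l hl => ?_
  have hR : I.Ready D τ := h.of_frame f rfl
  have hpos := hR.memberPos_eq (show I.n < I.n + 2 by omega) (show I.n + 1 < I.n + 2 by omega) x
  have hcast : ((I.n : ℕ) : ℤ) + 1 = ((I.n + 1 : ℕ) : ℤ) := by push_cast; rfl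
  simp only [Cmd.run, Expr.eval, hx, hR.n_eq, hcast, hpos, State.arr_setArr, if_true,
    f.arr 14 rfl, Function.update_apply, Nat.cast_inj]
  split_ifs with hlx
  · rw [hlx]
  · exact hτ l (by omega)

/-- The algorithm for maximum-profit independent task sets.

Registers: `0`, `1` and `2` hold `n`, `m` and `n + 2`; `3`, `4`, `5`, `6` are loop counters; `7` and
`8` hold a best value and a best choice, and `9` a vertex.

Arrays: `0` to `4` are the input, `5` the output; `6` marks end vertices, `7` holds the best edge of
each segment; `8`, `9`, `10` hold anchors, upper ends and lower ends of the boxes; `11` and `12`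
hold multiples of `n + 2` and of `(n + 2) ^ 2`; `13` and `14` hold values and solutions. -/
def program : Cmd := .seq prepare (.seq improve writeOutput)

theorem runs_program (I : UFPP) : Runs program I.input (300000 * (I.n ^ 4 + I.m + 1))
    fun τ => ∃ F, I.IsOutput τ F ∧ I.IsMaxITS F := by
  have hcells : ∀ σ, Frame prepare I.input σ → I.Table (boxes σ) σ fun _ _ => 0 :=
    fun σ f i k _ _ => cell_zero (fun x => by rw [f.arr 13 rfl]; rfl)
      (fun x => by rw [f.arr 14 rfl]; rfl) i k
  have hout : ∀ σ τ ω : State, I.Ready (boxes σ) σ → I.Table (boxes σ) τ (fun _ _ => I.n + 2) →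
      (∀ l : Fin I.n, ω.arr 5 (l : ℕ) = τ.arr 14 (memberPos I.n I.n (I.n + 1) l)) →
      ∃ F, I.IsOutput ω F ∧ I.IsMaxITS F := by
    intro σ τ ω h hτ hω
    obtain ⟨F, -, hF, -, hm, ho⟩ := hτ I.n (I.n + 1) (by omega) (by omega)
    refine ⟨F, fun l => by rw [hω, hm], hF, fun G hG => ho ?_ G (fun j _ => ?_) hG⟩
    · have := Finset.card_le_univ (I.between (boxes σ) I.n (I.n + 1))
      rw [Fintype.card_fin] at this
      exact Nat.lt_of_le_of_lt this (Nat.lt_add_of_pos_right two_pos)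
    · exact mem_between.2 (h.between j)
  refine (Runs.seq (runs_prepare I) fun σ f h => Runs.seq (runs_improve h (hcells σ f))
    fun τ f' hτ => (runs_writeOutput (h.of_frame f' rfl)).mono le_rfl
      fun ω _ hω => hout σ τ ω h hτ hω).mono ?_ fun _ _ h => h
  · have h₁ : I.n ≤ I.n ^ 4 := Nat.le_self_pow (by norm_num) _
    have h₂ : I.n ^ 2 ≤ I.n ^ 4 := by
      rcases I.n.eq_zero_or_pos with h | h
      · simp [h]
      · exact Nat.pow_le_pow_right h (by norm_num)
    have h₃ : I.n ^ 3 ≤ I.n ^ 4 := by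
      rcases I.n.eq_zero_or_pos with h | h
      · simp [h]
      · exact Nat.pow_le_pow_right h (by norm_num)
    ring_nf
    omega

end UFPP

theorem mainTheorem3 :
    ∃ (p : RAM.Cmd) (C : ℕ), ∀ I : UFPP,
      ∃ (t : ℕ) (σ : RAM.State) (F : Finset (Fin I.n)),
        RAM.Exec p I.input t σ ∧ I.IsOutput σ F ∧ I.IsMaxITS F ∧
        t ≤ C * (I.n ^ 4 + I.m + 1) ∧ (I.m < 2 * I.n → t ≤ C * I.n ^ 4) := by
  refine ⟨UFPP.program, 1200000, fun I => ?_⟩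
  obtain ⟨t, σ, he, ht, F, hout, hmax⟩ := UFPP.runs_program I
  refine ⟨t, σ, F, he, hout, hmax, by omega, fun hm => ?_⟩
  have h₁ : I.n ≤ I.n ^ 4 := Nat.le_self_pow (by norm_num) _
  omega
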